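/- **Setting.** Let $\Omega\subset\mathbb R^2$ be a (nonempty, open) convex polygonal domain and let $\Omega_1\subset\Omega$ be a nonempty open set with Lipschitz boundary $\Gamma=\partial\Omega_1\subset\Omega$; put $\Omega_2=\Omega\setminus\overline{\Omega_1}$ and let $\mathbf n$ be the unit normal on $\Gamma$ pointing out of $\Omega_1$. Let $\alpha=\alpha_1$ in $\Omega_1$ and $\alpha=\alpha_2$ in $\Omega_2$ with constants $\alpha_1,\alpha_2>0$, and let $\beta\in L^\infty(\Omega)$, $\beta\ge 0$ a.e. Write $(\cdot,\cdot)$, $\|\cdot\|_0$ for the inner product and the norm of $L^2(\Omega)$ or $L^2(\Omega;\mathbb R^2)$, $\langle g,v\rangle=\int_\Gamma g v\,ds$ (with $v\in H_0^1(\Omega)$ understood as its trace on $\Gamma$), $\|\cdot\|_{0,\Gamma}$ for the norm of $L^2(\Gamma)$, and $$a(u,v)=\int_\Omega\left(\alpha\nabla u\cdot\nabla v+\beta uv\right)dx,\qquad \|v\|_a=\sqrt{a(v,v)},\qquad u,v\in H_0^1(\Omega).$$ For $\mathbf p\in H(\mathrm{div},\Omega_1)\cap H(\mathrm{div},\Omega_2)$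 (that is, $\mathbf p|_{\Omega_i}\in H(\mathrm{div},\Omega_i)$ for $i=1,2$) let $\mathrm{div}\,\mathbf p$ be the piecewise divergence and let $[\mathbf n\cdot\mathbf p]=\mathbf n\cdot\mathbf p|_{\Omega_1}-\mathbf n\cdot\mathbf p|_{\Omega_2}$ be the jump of the normal component across $\Gamma$, where normal traces of $H(\mathrm{div})$ fields are understood in the usual sense as functionals on traces: the outward normal trace of $\mathbf p$ from $\Omega_i$ is $v\mapsto\int_{\Omega_i}(\mathbf p\cdot\nabla v+v\,\mathrm{div}\,\mathbf p)\,dx$, $v\in H^1_0(\Omega)$. **Theorem.** The eigenvalue problem "$0\ne w\in H_0^1(\Omega)$, $a(w,v)=\lambda\,(w,v)$ for all $v\in H_0^1(\Omega)$" has a smallest eigenvalue $\lambda_{\min}>0$, and the Steklov eigenvalue problem "$0\neq w\in H_0^1(\Omega)$, $a(w,v)=\lambda\,\langle w,v\rangle$ for all $v\in H_0^1(\Omega)$" has a smallest eigenvalue $\lambda_{1,\Gamma}>0$. Let $f\in L^2(\Omega)$, $g\in L^2(\Gamma)$, and let $u\in H_0^1(\Omega)$ be the weak solution of the interface problem with flux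 jump $g$, that is, $$a(u,v)=(f,v)+\langle g,v\rangle\qquad\text{for all } v\in H_0^1(\Omega).$$ Then for every $u_N\in H_0^1(\Omega)$ and every $\mathbf p\in H(\mathrm{div},\Omega_1)\cap H(\mathrm{div},\Omega_2)$, $$\|u-u_N\|_a\le\sqrt{1+\frac1{\lambda_{\min}}+\frac1{\lambda_{1,\Gamma}}}\;\eta(u_N,\mathbf p),$$ $$\eta(u_N,\mathbf p)=\left(\|f-\beta u_N+\mathrm{div}\,\mathbf p\|_0^2+\|\alpha^{-1/2}(\mathbf p-\alpha\nabla u_N)\|_0^2+\|g-[\mathbf n\cdot\mathbf p]\|_{0,\Gamma}^2\right)^{1/2},$$ where $\|g-[\mathbf n\cdot\mathbf p]\|_{0,\Gamma}=\infty$ (and so $\eta(u_N,\mathbf p)=\infty$) if $[\mathbf n\cdot\mathbf p]\notin L^2(\Gamma)$. -/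

import Mathlib

open MeasureTheory Filter Topology TopologicalSpace
open scoped ENNReal NNReal Distributions Gradient

noncomputable section

namespace Interface

/-- The Euclidean plane. -/
abbrev Plane : Type := EuclideanSpace ℝ (Fin 2)

/-! ### Geometry -/

/-- `Ω` is a (nonempty, open) convex polygon: the nonempty interior of the convex hull of finitely
many points. -/
def IsConvexPolygon (Ω : Opens Plane) : Prop :=
  (Ω : Set Plane).Nonempty ∧ ∃ S : Finset Plane, (Ω : Set Plane) = interior (convexHull ℝ ↑S)

/-- `D` has a Lipschitz boundary: near each boundary point, in suitable orthonormal coordinates,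
`D` is the region strictly above the graph of a Lipschitz function. -/
def HasLipschitzBoundary (D : Set Plane) : Prop :=
  ∀ x ∈ frontier D, ∃ (e : Plane ≃ₗᵢ[ℝ] Plane) (ψ : ℝ → ℝ) (K : ℝ≥0) (r : ℝ),
    LipschitzWith K ψ ∧ 0 < r ∧
      D ∩ Metric.ball x r = {y | ψ (e y 0) < e y 1} ∩ Metric.ball x r

/-- The outer subdomain, as an open set: `Ω` minus the closure of the inner subdomain `Ω₁`. -/
def outer (Ω Ω₁ : Opens Plane) : Opens Plane :=
  ⟨(Ω : Set Plane) \ closure (Ω₁ : Set Plane), Ω.isOpen.sdiff isClosed_closure⟩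

/-- Lebesgue (area) measure on a subdomain. -/
abbrev area (D : Opens Plane) : Measure Plane := volume.restrict (D : Set Plane)

/-- The arc length measure `ds` on the interface `Γ = ∂Ω₁` (one-dimensional Hausdorff measure). -/
abbrev arc (Ω₁ : Opens Plane) : Measure Plane :=
  (Measure.hausdorffMeasure 1).restrict (frontier (Ω₁ : Set Plane))

/-! ### The Sobolev space `H₀¹(Ω)` -/

/-- Pairs `(u, G)` in `L²(Ω) × L²(Ω; ℝ²)` with the Hilbert norm `(‖u‖² + ‖G‖²)^(1/2)`.
The space `H¹(Ω)` sits isometrically in it as the set of pairs `(u, ∇u)`. -/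
abbrev L2Pair (Ω : Opens Plane) : Type :=
  WithLp 2 (Lp ℝ 2 (area Ω) × Lp Plane 2 (area Ω))

theorem memLp_test {Ω : Opens Plane} (φ : 𝓓(Ω, ℝ)) : MemLp φ 2 (area Ω) :=
  (φ.continuous.memLp_of_hasCompactSupport φ.hasCompactSupport).restrict _

theorem differentiable_test {Ω : Opens Plane} (φ : 𝓓(Ω, ℝ)) : Differentiable ℝ φ :=
  φ.contDiff.differentiable (by simp)

theorem memLp_gradient_test {Ω : Opens Plane} (φ : 𝓓(Ω, ℝ)) :
    MemLp (fun x => ∇ (φ : Plane → ℝ) x) 2 (area Ω) := by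
  have hc : Continuous (fun x => ∇ (φ : Plane → ℝ) x) :=
    (InnerProductSpace.toDual ℝ Plane).symm.continuous.comp (φ.contDiff.continuous_fderiv (by simp))
  have hs : HasCompactSupport (fun x => ∇ (φ : Plane → ℝ) x) :=
    (φ.hasCompactSupport.fderiv ℝ).comp_left
      (g := (InnerProductSpace.toDual ℝ Plane).symm) (map_zero _)
  exact (hc.memLp_of_hasCompactSupport hs).restrict _

/-- The map `φ ↦ (φ, ∇φ)` on test functions `φ ∈ C_c^∞(Ω)`. -/
def testPair (Ω : Opens Plane) : 𝓓(Ω, ℝ) →ₗ[ℝ] L2Pair Ω where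
  toFun φ := WithLp.toLp 2 ((memLp_test φ).toLp _, (memLp_gradient_test φ).toLp _)
  map_add' φ χ := by
    rw [← WithLp.toLp_add, Prod.mk_add_mk, ← MemLp.toLp_add, ← MemLp.toLp_add]
    congr 2
    refine MemLp.toLp_congr _ _ (Eventually.of_forall fun x => ?_)
    change (InnerProductSpace.toDual ℝ Plane).symm (fderiv ℝ ((φ : Plane → ℝ) + χ) x) = _
    rw [fderiv_add (differentiable_test φ x) (differentiable_test χ x), map_add]
    rfl
  map_smul' c φ := by
    rw [RingHom.id_apply, ← WithLp.toLp_smul, Prod.smul_mk, ← MemLp.toLp_const_smul,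
      ← MemLp.toLp_const_smul]
    congr 2
    refine MemLp.toLp_congr _ _ (Eventually.of_forall fun x => ?_)
    change (InnerProductSpace.toDual ℝ Plane).symm (fderiv ℝ (c • (φ : Plane → ℝ)) x) = _
    rw [fderiv_const_smul (differentiable_test φ x), map_smulₛₗ]
    rfl

/-- `H₀¹(Ω)`, the closure of `C_c^∞(Ω)` in the `H¹` norm `(‖u‖₀² + ‖∇u‖₀²)^(1/2)`. An element is
recorded as the pair `(u, ∇u)`: the second component, as an `L²` limit of gradients of test functions
that converge to the first in `L²`, is the weak gradient of the first, and is determined by it. -/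
abbrev H10 (Ω : Opens Plane) : Submodule ℝ (L2Pair Ω) :=
  (LinearMap.range (testPair Ω)).topologicalClosure

/-- The underlying `L²` function of `u ∈ H₀¹(Ω)`. -/
def fn {Ω : Opens Plane} (u : H10 Ω) : Plane → ℝ := (u : L2Pair Ω).fst

/-- The gradient of `u ∈ H₀¹(Ω)`. -/
def grad {Ω : Opens Plane} (u : H10 Ω) : Plane → Plane := (u : L2Pair Ω).snd

/-- `τ` is the trace on `Γ = ∂Ω₁` of `u ∈ H₀¹(Ω)`: the `L²(Γ)` limit of the restrictions to `Γ` of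
test functions that converge to `u` in `H₀¹(Ω)`. -/
def IsTrace {Ω : Opens Plane} (Ω₁ : Opens Plane) (u : H10 Ω) (τ : Plane → ℝ) : Prop :=
  MemLp τ 2 (arc Ω₁) ∧ ∃ φ : ℕ → 𝓓(Ω, ℝ),
    Tendsto (fun n => testPair Ω (φ n)) atTop (𝓝 (u : L2Pair Ω)) ∧
    Tendsto (fun n => eLpNorm (fun x => φ n x - τ x) 2 (arc Ω₁)) atTop (𝓝 0)

open Classical in
/-- The trace on `Γ = ∂Ω₁` of a function in `H₀¹(Ω)`. -/
def trace {Ω : Opens Plane} (Ω₁ : Opens Plane) (u : H10 Ω) : Plane → ℝ :=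
  if h : ∃ τ, IsTrace Ω₁ u τ then h.choose else 0

/-! ### The interface problem -/

open Classical in
/-- The diffusion coefficient: `α₁` on `Ω₁` and `α₂` elsewhere. -/
def coeff (Ω₁ : Opens Plane) (α₁ α₂ : ℝ) (x : Plane) : ℝ := if x ∈ Ω₁ then α₁ else α₂

/-- The bilinear form `a(u,v) = ∫_Ω (α ∇u ⬝ ∇v + β u v)`. -/
def form {Ω : Opens Plane} (α β : Plane → ℝ) (u v : H10 Ω) : ℝ :=
  ∫ x, (α x * inner ℝ (grad u x) (grad v x) + β x * fn u x * fn v x) ∂(area Ω)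

/-- The energy norm `‖v‖_a`. -/
def energyNorm {Ω : Opens Plane} (α β : Plane → ℝ) (v : H10 Ω) : ℝ := √(form α β v v)

/-- The `L²(Ω)` pairing `(f, v)`. -/
def pairing {Ω : Opens Plane} (f : Plane → ℝ) (v : H10 Ω) : ℝ := ∫ x, f x * fn v x ∂(area Ω)

/-- The pairing `⟨g, v⟩ = ∫_Γ g v ds` with `Γ = ∂Ω₁`. -/
def arcPairing {Ω : Opens Plane} (Ω₁ : Opens Plane) (g : Plane → ℝ) (v : H10 Ω) : ℝ :=
  ∫ x, g x * trace Ω₁ v x ∂(arc Ω₁)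

/-- `u ∈ H₀¹(Ω)` solves `a(u,v) = (f,v) + ⟨g,v⟩` for all `v ∈ H₀¹(Ω)`. -/
def IsWeakSolution {Ω : Opens Plane} (Ω₁ : Opens Plane) (α β f g : Plane → ℝ) (u : H10 Ω) : Prop :=
  ∀ v : H10 Ω, form α β u v = pairing f v + arcPairing Ω₁ g v

/-- The eigenvalues of the problem `a(w,v) = μ (w,v)` for all `v ∈ H₀¹(Ω)`. -/
def dirichletEigenvalues (Ω : Opens Plane) (α β : Plane → ℝ) : Set ℝ :=
  {μ | ∃ w : H10 Ω, w ≠ 0 ∧ ∀ v : H10 Ω, form α β w v = μ * pairing (fn w) v}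

/-- The eigenvalues of the Steklov problem `a(w,v) = μ ⟨w,v⟩` for all `v ∈ H₀¹(Ω)`. -/
def steklovEigenvalues (Ω Ω₁ : Opens Plane) (α β : Plane → ℝ) : Set ℝ :=
  {μ | ∃ w : H10 Ω, w ≠ 0 ∧ ∀ v : H10 Ω, form α β w v = μ * arcPairing Ω₁ (trace Ω₁ w) v}

/-! ### `H(div)` and the jump of the normal component -/

/-- `d` is the weak divergence of `p` in `D`. -/
def IsWeakDiv (D : Opens Plane) (p : Plane → Plane) (d : Plane → ℝ) : Prop :=
  ∀ φ : 𝓓(D, ℝ), ∫ x, inner ℝ (p x) (∇ (φ : Plane → ℝ) x) ∂(area D) = -∫ x, d x * φ x ∂(area D)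

/-- The space `H(div, D)`: square integrable fields with a square integrable weak divergence. -/
def Hdiv (D : Opens Plane) : Set (Plane → Plane) :=
  {p | MemLp p 2 (area D) ∧ ∃ d, MemLp d 2 (area D) ∧ IsWeakDiv D p d}

open Classical in
/-- The weak divergence in `D` of a field in `H(div, D)`. -/
def weakDiv (D : Opens Plane) (p : Plane → Plane) : Plane → ℝ :=
  if h : ∃ d, MemLp d 2 (area D) ∧ IsWeakDiv D p d then h.choose else 0

/-- The piecewise divergence of `p ∈ H(div, Ω₁) ∩ H(div, Ω₂)`, where `Ω₂` is the outer
subdomain. -/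
def pwDiv (Ω Ω₁ : Opens Plane) (p : Plane → Plane) (x : Plane) : ℝ :=
  (Ω₁ : Set Plane).indicator (weakDiv Ω₁ p) x +
    (outer Ω Ω₁ : Set Plane).indicator (weakDiv (outer Ω Ω₁) p) x

/-- The trace on `∂D` of the outward normal component of `p ∈ H(div, D)`, as usual a functional on
boundary values of `H¹` functions: `⟨n_D ⬝ p, v⟩ = ∫_D (p ⬝ ∇v + (div p) v)`. For `v ∈ H₀¹(Ω)` the
part of `∂D` on `∂Ω` does not contribute. -/
def normalTrace {Ω : Opens Plane} (D : Opens Plane) (p : Plane → Plane) (v : H10 Ω) : ℝ :=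
  ∫ x, (inner ℝ (p x) (grad v x) + weakDiv D p x * fn v x) ∂(area D)

/-- The jump `[n ⬝ p] = n ⬝ p|_{Ω₁} - n ⬝ p|_{Ω₂}` across `Γ = ∂Ω₁`, as a functional on `H₀¹(Ω)`.
The normal `n` points out of `Ω₁`, hence into `Ω₂`, so `n ⬝ p|_{Ω₂}` is minus the outward
normal trace from `Ω₂`. -/
def normalJump {Ω : Opens Plane} (Ω₁ : Opens Plane) (p : Plane → Plane) (v : H10 Ω) : ℝ :=
  normalTrace Ω₁ p v - (-normalTrace (outer Ω Ω₁) p v)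

/-- The norm `‖ℓ‖_{0,Γ}` of a functional `ℓ` of boundary values on `Γ = ∂Ω₁`: the `L²(Γ)` norm of
the function that represents `ℓ` if there is one, and `∞` if `ℓ` is not in `L²(Γ)`. -/
def arcNorm {Ω : Opens Plane} (Ω₁ : Opens Plane) (ℓ : H10 Ω → ℝ) : ℝ≥0∞ :=
  ⨅ (h : Plane → ℝ) (_ : MemLp h 2 (arc Ω₁) ∧ ∀ v : H10 Ω, ℓ v = arcPairing Ω₁ h v),
    eLpNorm h 2 (arc Ω₁)

/-- The error estimator
`η(u_N,p) = (‖f - β u_N + div p‖₀² + ‖α^(-1/2) (p - α ∇u_N)‖₀² + ‖g - [n ⬝ p]‖_{0,Γ}²)^(1/2)`. -/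
def eta {Ω : Opens Plane} (Ω₁ : Opens Plane) (α β f g : Plane → ℝ) (uN : H10 Ω)
    (p : Plane → Plane) : ℝ≥0∞ :=
  (eLpNorm (fun x => f x - β x * fn uN x + pwDiv Ω Ω₁ p x) 2 (area Ω) ^ 2
    + eLpNorm (fun x => (α x) ^ (-(1 / 2) : ℝ) • (p x - α x • grad uN x)) 2 (area Ω) ^ 2
    + arcNorm Ω₁ (fun v : H10 Ω => arcPairing Ω₁ g v - normalJump Ω₁ p v) ^ 2) ^ (1 / 2 : ℝ)

end Interface

end

/-! Put e = u - u_N. The normal trace is defined by Green's formula and Γ has zero area, so the jump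
of p is a single integral over Ω, and the weak formulation becomes the error equation a(e,e) = (f -
βu_N + div p, e) + (α^(-1/2)(p - α∇u_N), α^(1/2)∇e) + ⟨g - [n⬝p], e⟩. Cauchy-Schwarz bounds the
right side by η times (‖e‖₀² + ‖α^(1/2)∇e‖₀² + ‖e‖²_{0,Γ})^(1/2). The middle square is at most
a(e,e) because β ≥ 0, and the other two are at most a(e,e)/λ_min and a(e,e)/λ_{1,Γ} by the Rayleigh
characterization of the eigenvalues. One factor ‖e‖_a cancels and the constant appears
(`energy_sq_le`, `sq_le_of_le_sum_mul`).

Both eigenvalues are minima of a(v,v)/‖Tv‖², where T is the embedding into L²(Ω) or the trace into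
L²(Γ). `exists_rayleigh_minimizer` treats both at once: it needs a coercive, bounded, symmetric form
and a compact T ≠ 0. The parallelogram law turns convergence of Tv_n into convergence of the
minimizing sequence itself, and the eigenvalue equation is the equality case of Cauchy-Schwarz for
the nonnegative form a - λ(T·,T·).

Compactness rests on two inequalities for test functions, extended by density. Friedrichs'
inequality on a fine grid (`exists_friedrichs`) controls ‖u‖₀² by ε‖∇u‖₀² and finitely many
integrals over cells, which yields Rellich's theorem through an Ehrling type criterion. The
multiplicative trace inequality ‖u‖²_{0,Γ} ≤ C‖u‖₀‖∇u‖₀ (`exists_trace_inequality`) then passes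
compactness on to the trace operator. -/

noncomputable section

namespace Interface

/-! ### Compactness and Rayleigh quotients -/

/-- An Ehrling type inequality transfers total boundedness of the image of the unit ball. -/
theorem totallyBounded_image_of_norm_le {H L : Type} [NormedAddCommGroup H] [NormedSpace ℝ H]
    [NormedAddCommGroup L] [NormedSpace ℝ L] (T : H →L[ℝ] L)
    (h : ∀ ε : ℝ, 0 < ε → ∃ (F : Type) (_ : NormedAddCommGroup F) (_ : NormedSpace ℝ F)
      (S : H →L[ℝ] F) (C : ℝ), TotallyBounded (S '' Metric.closedBall 0 1) ∧
        ∀ x, ‖T x‖ ≤ ε * ‖x‖ + C * ‖S x‖) :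
    TotallyBounded (T '' Metric.closedBall 0 1) := by
  rw [Metric.totallyBounded_iff]
  intro δ hδ
  -- Two points of the unit ball are at distance at most 2, so the ε term contributes at most δ/4.
  -- The net below makes the `S` term at most δ/2, and the total stays below δ.
  obtain ⟨F, _, _, S, C, hS, hT⟩ := h (δ / 8) (by positivity)
  set D : ℝ := |C| + 1 with hD
  have hDpos : 0 < D := by positivity
  obtain ⟨t, htsub, htfin, htcov⟩ :=
    Metric.finite_approx_of_totallyBounded hS (δ / (2 * D)) (by positivity)
  choose! g hg using fun y (hy : y ∈ t) => htsub hy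
  refine ⟨(fun y => T (g y)) '' t, htfin.image _, ?_⟩
  rintro _ ⟨x, hx, rfl⟩
  obtain ⟨y, hy, hxy⟩ := Set.mem_iUnion₂.1 (htcov ⟨x, hx, rfl⟩)
  refine Set.mem_iUnion₂.2 ⟨_, ⟨y, hy, rfl⟩, ?_⟩
  rw [Metric.mem_ball, dist_eq_norm] at hxy ⊢
  obtain ⟨hgy, hSg⟩ := hg y hy
  rw [← hSg, ← map_sub] at hxy
  rw [← map_sub]
  have h1 : ‖x - g y‖ ≤ 2 := by
    have := norm_sub_le x (g y)
    simp only [Metric.mem_closedBall, dist_zero_right] at hx hgy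
    linarith
  have h2 : C * ‖S (x - g y)‖ ≤ δ / 2 := by
    calc C * ‖S (x - g y)‖ ≤ D * (δ / (2 * D)) :=
          mul_le_mul ((le_abs_self C).trans (by simp [hD])) hxy.le (norm_nonneg _) hDpos.le
      _ = δ / 2 := by field_simp
  nlinarith [hT (x - g y)]

theorem exists_subseq_tendsto_of_totallyBounded {H L : Type} [NormedAddCommGroup H]
    [NormedSpace ℝ H] [NormedAddCommGroup L] [NormedSpace ℝ L] [CompleteSpace L] (T : H →L[ℝ] L)
    (hT : TotallyBounded (T '' Metric.closedBall 0 1)) (x : ℕ → H) (R : ℝ) (hR : 0 < R)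
    (hx : ∀ n, ‖x n‖ ≤ R) :
    ∃ (y : L) (s : ℕ → ℕ), StrictMono s ∧ Tendsto (fun n => T (x (s n))) atTop (𝓝 y) := by
  have hc : IsCompact (closure (T '' Metric.closedBall 0 1)) :=
    hT.closure.isCompact_of_isClosed isClosed_closure
  obtain ⟨y, -, s, hs, hy⟩ := hc.tendsto_subseq (x := fun n => T (R⁻¹ • x n)) fun n =>
    subset_closure ⟨_, by
      rw [Metric.mem_closedBall, dist_zero_right, norm_smul, norm_inv, Real.norm_of_nonneg hR.le]
      rw [inv_mul_le_iff₀ hR, mul_one]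
      exact hx n, rfl⟩
  refine ⟨R • y, s, hs, ?_⟩
  refine (hy.const_smul R).congr fun n => ?_
  simp [hR.ne']

/-- A coercive bounded symmetric form `B` has, relative to a compact operator `T ≠ 0`, a smallest
Rayleigh quotient `B v v / ‖T v‖²`; it is positive, and it is attained at an eigenvector. -/
theorem exists_rayleigh_minimizer {H L : Type} [NormedAddCommGroup H] [NormedSpace ℝ H]
    [CompleteSpace H] [NormedAddCommGroup L] [InnerProductSpace ℝ L] [CompleteSpace L]
    (B : LinearMap.BilinForm ℝ H) (hB : ∀ u v, B u v = B v u) (m M : ℝ) (hm : 0 < m)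
    (hmB : ∀ v, m * ‖v‖ ^ 2 ≤ B v v) (hMB : ∀ v, B v v ≤ M * ‖v‖ ^ 2) (T : H →L[ℝ] L)
    (hT : TotallyBounded (T '' Metric.closedBall 0 1)) (x₀ : H) (hx₀ : T x₀ ≠ 0) :
    ∃ lam : ℝ, 0 < lam ∧ (∃ w : H, w ≠ 0 ∧ ∀ v, B w v = lam * inner ℝ (T w) (T v)) ∧
      ∀ v, lam * ‖T v‖ ^ 2 ≤ B v v := by
  have hnn : ∀ v, 0 ≤ B v v := fun v => (by positivity : (0:ℝ) ≤ m * ‖v‖ ^ 2).trans (hmB v)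
  set S : Set ℝ := {r | ∃ v, ‖T v‖ = 1 ∧ B v v = r} with hS
  have hSbdd : BddBelow S := ⟨0, by rintro _ ⟨v, -, rfl⟩; exact hnn v⟩
  have hSne : S.Nonempty := ⟨_, ‖T x₀‖⁻¹ • x₀, by
    rw [map_smul, norm_smul, norm_inv, norm_norm, inv_mul_cancel₀ (norm_ne_zero_iff.2 hx₀)], rfl⟩
  set lam := sInf S with hlam
  have hlam0 : 0 ≤ lam := Real.sInf_nonneg (by rintro _ ⟨v, -, rfl⟩; exact hnn v)
  have hle : ∀ v, lam * ‖T v‖ ^ 2 ≤ B v v := by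
    intro v
    by_cases hv : T v = 0
    · simpa [hv] using hnn v
    have hpos : 0 < ‖T v‖ := norm_pos_iff.2 hv
    have : lam ≤ B (‖T v‖⁻¹ • v) (‖T v‖⁻¹ • v) := csInf_le hSbdd
      ⟨_, by rw [map_smul, norm_smul, norm_inv, norm_norm, inv_mul_cancel₀ hpos.ne'], rfl⟩
    simp only [map_smul, LinearMap.smul_apply, smul_eq_mul] at this
    calc lam * ‖T v‖ ^ 2 ≤ (‖T v‖⁻¹ * (‖T v‖⁻¹ * B v v)) * ‖T v‖ ^ 2 := by gcongr
      _ = B v v := by field_simp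
  have hseq : ∀ n : ℕ, ∃ v, ‖T v‖ = 1 ∧ B v v < lam + 1 / ((n : ℝ) + 1) := by
    intro n
    obtain ⟨_, ⟨v, hv, rfl⟩, hlt⟩ := exists_lt_of_csInf_lt hSne
      (show sInf S < lam + 1 / ((n : ℝ) + 1) by rw [← hlam]; simp; positivity)
    exact ⟨v, hv, hlt⟩
  choose x hxT hxB using hseq
  have hxb : ∀ n, ‖x n‖ ≤ √((lam + 1) / m) := by
    intro n
    apply Real.le_sqrt_of_sq_le
    rw [le_div_iff₀ hm]
    have h1 : 1 / ((n : ℝ) + 1) ≤ 1 := by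
      rw [div_le_one (by positivity)]; linarith [n.cast_nonneg (α := ℝ)]
    linarith [hmB (x n), hxB n]
  obtain ⟨y, s, hs, hy⟩ := exists_subseq_tendsto_of_totallyBounded T hT x _
    (by positivity) hxb
  -- Parallelogram law in both spaces: B(a-b) = 2B(a) + 2B(b) - B(a+b), while B(a+b) ≥ lam‖T(a+b)‖²
  -- = lam(4 - ‖Ta-Tb‖²). For late terms this leaves B(a-b) ≤ 4η + η, and 5η < mε² with η = mε²/8.
  have hcs : CauchySeq (fun n => x (s n)) := by
    have hTc := hy.cauchySeq
    rw [Metric.cauchySeq_iff] at hTc ⊢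
    intro ε hε
    set η : ℝ := m * ε ^ 2 / 8 with hη
    have hηpos : 0 < η := by positivity
    obtain ⟨N₁, hN₁⟩ := hTc (√(η / (lam + 1))) (by positivity)
    obtain ⟨N₂, hN₂⟩ := exists_nat_one_div_lt hηpos
    refine ⟨max N₁ N₂, fun i hi j hj => ?_⟩
    have hsmall : ∀ k, max N₁ N₂ ≤ k → B (x (s k)) (x (s k)) ≤ lam + η := by
      intro k hk
      have h1 : (N₂ : ℝ) ≤ s k := by exact_mod_cast ((le_max_right _ _).trans hk).trans (hs.id_le k)
      have h2 : 1 / ((s k : ℝ) + 1) ≤ 1 / ((N₂ : ℝ) + 1) := by gcongr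
      linarith [hxB (s k)]
    set a := x (s i)
    set b := x (s j)
    have hpar : B (a - b) (a - b) = 2 * B a a + 2 * B b b - B (a + b) (a + b) := by
      simp only [map_sub, map_add, LinearMap.sub_apply, LinearMap.add_apply]; ring
    have hTpar : ‖T (a + b)‖ ^ 2 = 4 - ‖T a - T b‖ ^ 2 := by
      have := parallelogram_law_with_norm ℝ (T a) (T b)
      rw [hxT (s i), hxT (s j), ← map_add] at this
      nlinarith
    have hd : ‖T a - T b‖ ^ 2 ≤ η / (lam + 1) := by
      have h := (hN₁ i ((le_max_left _ _).trans hi) j ((le_max_left _ _).trans hj)).le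
      rw [dist_eq_norm] at h
      calc ‖T a - T b‖ ^ 2 ≤ √(η / (lam + 1)) ^ 2 := by gcongr
        _ = _ := Real.sq_sqrt (by positivity)
    have hd' : lam * ‖T a - T b‖ ^ 2 ≤ η := by
      calc lam * ‖T a - T b‖ ^ 2 ≤ (lam + 1) * (η / (lam + 1)) := by gcongr; linarith
        _ = η := by field_simp
    have h1 := hle (a + b)
    rw [hTpar] at h1
    have h2 := hmB (a - b)
    have h3 : m * ‖a - b‖ ^ 2 ≤ 5 * η := by
      linarith [hsmall i hi, hsmall j hj]
    rw [dist_eq_norm]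
    by_contra hcon
    push Not at hcon
    have : m * ε ^ 2 ≤ m * ‖a - b‖ ^ 2 := by gcongr
    have : 0 < m * ε ^ 2 := by positivity
    linarith
  obtain ⟨w, hw⟩ := cauchySeq_tendsto_of_complete hcs
  have hTw : T w = y := tendsto_nhds_unique ((T.continuous.tendsto w).comp hw) hy
  have hyn : ‖y‖ = 1 := tendsto_nhds_unique hy.norm (by simp [hxT])
  have hTw1 : ‖T w‖ = 1 := by rw [hTw, hyn]
  have hw0 : w ≠ 0 := by rintro rfl; simp at hTw1
  have hMn : ∀ v, B v v ≤ |M| * ‖v‖ ^ 2 := fun v => (hMB v).trans (by gcongr; exact le_abs_self M)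
  -- Lower semicontinuity by convexity: B(x) ≥ B(w) + 2B(w, x-w), and the linear term vanishes in
  -- the limit.
  have hBw : B w w ≤ lam := by
    have hBx : Tendsto (fun n => lam + 1 / ((s n : ℝ) + 1)) atTop (𝓝 (lam + 0)) :=
      (tendsto_one_div_add_atTop_nhds_zero_nat.comp hs.tendsto_atTop).const_add lam
    have hd0 : Tendsto (fun n => x (s n) - w) atTop (𝓝 0) := by
      simpa using hw.sub_const w
    have hlin : Tendsto (fun n => B w (x (s n) - w)) atTop (𝓝 0) := by
      have hb : ∀ v, |B w v| ≤ √(B w w * |M|) * ‖v‖ := by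
        intro v
        rw [← Real.sqrt_sq (norm_nonneg v), ← Real.sqrt_mul (by have := hnn w; positivity)]
        apply Real.abs_le_sqrt
        refine (LinearMap.BilinForm.apply_sq_le_of_symm B hnn ⟨fun u v => hB u v⟩ w v).trans ?_
        rw [mul_assoc]
        exact mul_le_mul_of_nonneg_left (hMn v) (hnn w)
      refine squeeze_zero_norm (fun n => hb _) ?_
      simpa using hd0.norm.const_mul (√(B w w * |M|))
    have hlow : Tendsto (fun n => B w w + 2 * B w (x (s n) - w)) atTop (𝓝 (B w w + 2 * 0)) :=
      (hlin.const_mul 2).const_add _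
    have := le_of_tendsto_of_tendsto' hlow hBx fun n => by
      have h1 : B (x (s n)) (x (s n)) = B w w + 2 * B w (x (s n) - w)
          + B (x (s n) - w) (x (s n) - w) := by
        simp only [map_sub, LinearMap.sub_apply]
        rw [hB (x (s n)) w]
        ring
      linarith [hnn (x (s n) - w), hxB (s n)]
    simpa using this
  have hlampos : 0 < lam := by
    have : 0 < ‖w‖ := norm_pos_iff.2 hw0
    have : 0 < m * ‖w‖ ^ 2 := by positivity
    linarith [hmB w]
  refine ⟨lam, hlampos, ⟨w, hw0, fun v => ?_⟩, hle⟩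
  -- `Q` is nonnegative and vanishes at `w`, so Cauchy-Schwarz for `Q` forces Q(w,v) = 0 for every
  -- v. This is the Euler-Lagrange equation.
  set Q : LinearMap.BilinForm ℝ H :=
    B - lam • (innerₗ L).compl₁₂ T.toLinearMap T.toLinearMap with hQ
  have hQa : ∀ u v, Q u v = B u v - lam * inner ℝ (T u) (T v) := fun u v => rfl
  have hQs : LinearMap.IsSymm Q := ⟨fun u v => by
    rw [hQa, hQa, hB u v, real_inner_comm]; rfl⟩
  have hQn : ∀ u, 0 ≤ Q u u := fun u => by
    rw [hQa, real_inner_self_eq_norm_sq]; linarith [hle u]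
  have hQw : Q w w = 0 := le_antisymm (by
    rw [hQa, real_inner_self_eq_norm_sq, hTw1]; linarith) (hQn w)
  have := LinearMap.BilinForm.apply_sq_le_of_symm Q hQn hQs w v
  rw [hQw, zero_mul] at this
  have h0 : Q w v = 0 := by nlinarith
  rw [hQa] at h0
  linarith

/-! ### Calculus inequalities for continuously differentiable functions -/

theorem sq_integral_mul_le {X : Type*} [MeasurableSpace X] {μ : Measure X} {f g : X → ℝ}
    (hf : MemLp f 2 μ) (hg : MemLp g 2 μ) :
    (∫ x, f x * g x ∂μ) ^ 2 ≤ (∫ x, f x ^ 2 ∂μ) * ∫ x, g x ^ 2 ∂μ := by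
  have key : ∀ {f g : X → ℝ} (hf : MemLp f 2 μ) (hg : MemLp g 2 μ),
      inner ℝ (hf.toLp f) (hg.toLp g) = ∫ x, f x * g x ∂μ := by
    intro f g hf hg
    rw [L2.inner_def]
    refine integral_congr_ae ?_
    filter_upwards [hf.coeFn_toLp, hg.coeFn_toLp] with x h1 h2
    rw [h1, h2, real_inner_eq_re_inner, RCLike.inner_apply]
    simp [mul_comm]
  have h := real_inner_mul_inner_self_le (hf.toLp f) (hg.toLp g)
  rw [key hf hg, key hf hf, key hg hg] at h
  simpa only [sq] using h

/-- The variance ∫(g - m)² about the mean m is nonnegative. -/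
theorem sq_intervalIntegral_le {g : ℝ → ℝ} (hg : Continuous g) {a b : ℝ} (hab : a ≤ b) :
    (∫ x in a..b, g x) ^ 2 ≤ (b - a) * ∫ x in a..b, g x ^ 2 := by
  rcases hab.eq_or_lt with rfl | hlt
  · simp
  set m := (∫ x in a..b, g x) / (b - a) with hm
  have hba : 0 < b - a := sub_pos.2 hlt
  have h0 : 0 ≤ ∫ x in a..b, (g x - m) ^ 2 :=
    intervalIntegral.integral_nonneg hab fun x _ => sq_nonneg _
  have h1 : ∫ x in a..b, (g x - m) ^ 2
      = (∫ x in a..b, g x ^ 2) - 2 * m * (∫ x in a..b, g x) + m ^ 2 * (b - a) := by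
    have : ∀ x, (g x - m) ^ 2 = (g x ^ 2 - 2 * m * g x) + m ^ 2 := fun x => by ring
    simp_rw [this]
    rw [intervalIntegral.integral_add, intervalIntegral.integral_sub,
      intervalIntegral.integral_const_mul, intervalIntegral.integral_const, smul_eq_mul]
    · ring
    all_goals exact Continuous.intervalIntegrable (by fun_prop) _ _
  have h2 : ∫ x in a..b, g x = m * (b - a) := by rw [hm]; field_simp
  rw [h1, h2] at h0
  rw [h2]
  nlinarith

theorem sq_sub_le_mul_integral_deriv_sq {g g' : ℝ → ℝ} (hg : ∀ x, HasDerivAt g (g' x) x)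
    (hg' : Continuous g') {a b x c : ℝ} (hx : x ∈ Set.Icc a b) (hc : c ∈ Set.Icc a b) :
    (g x - g c) ^ 2 ≤ (b - a) * ∫ t in a..b, g' t ^ 2 := by
  wlog hcx : c ≤ x generalizing x c
  · rw [← neg_sub, neg_sq]
    exact this hc hx (le_of_not_ge hcx)
  rw [← intervalIntegral.integral_eq_sub_of_hasDerivAt (fun t _ => hg t)
    (hg'.intervalIntegrable _ _)]
  refine (sq_intervalIntegral_le hg' hcx).trans ?_
  have h1 : ∫ t in c..x, g' t ^ 2 ≤ ∫ t in a..b, g' t ^ 2 :=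
    intervalIntegral.integral_mono_interval hc.1 hcx hx.2
      (Eventually.of_forall fun t => sq_nonneg _)
      (Continuous.intervalIntegrable (by fun_prop) _ _)
  have h2 : 0 ≤ ∫ t in c..x, g' t ^ 2 :=
    intervalIntegral.integral_nonneg hcx fun t _ => sq_nonneg _
  exact mul_le_mul (by linarith [hx.2, hc.1]) h1 h2 (by linarith [hx.2, hx.1])

/-- A continuous g attains its mean m at some point c, so (g - m)² is bounded pointwise by (b -
a)∫g'². Integration bounds the variance, and the mean accounts for the last term. -/
theorem integral_sq_le_of_interval {g g' : ℝ → ℝ} (hg : ∀ x, HasDerivAt g (g' x) x)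
    (hg' : Continuous g') {a b : ℝ} (hab : a < b) :
    ∫ x in a..b, g x ^ 2 ≤ (b - a) ^ 2 * (∫ x in a..b, g' x ^ 2)
      + (b - a)⁻¹ * (∫ x in a..b, g x) ^ 2 := by
  have hgc : Continuous g := continuous_iff_continuousAt.2 fun x => (hg x).continuousAt
  have hba : 0 < b - a := sub_pos.2 hab
  obtain ⟨c, hc, hcm⟩ := exists_eq_interval_average hab.ne hgc.continuousOn
  rw [interval_average_eq_div] at hcm
  rw [Set.uIoo_of_le hab.le] at hc
  set m := (∫ x in a..b, g x) / (b - a) with hm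
  have h1 : ∫ x in a..b, (g x - m) ^ 2
      = (∫ x in a..b, g x ^ 2) - 2 * m * (∫ x in a..b, g x) + m ^ 2 * (b - a) := by
    have : ∀ x, (g x - m) ^ 2 = (g x ^ 2 - 2 * m * g x) + m ^ 2 := fun x => by ring
    simp_rw [this]
    rw [intervalIntegral.integral_add, intervalIntegral.integral_sub,
      intervalIntegral.integral_const_mul, intervalIntegral.integral_const, smul_eq_mul]
    · ring
    all_goals exact Continuous.intervalIntegrable (by fun_prop) _ _
  have h2 : ∫ x in a..b, (g x - m) ^ 2
      ≤ ∫ _ in a..b, (b - a) * ∫ t in a..b, g' t ^ 2 := by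
    refine intervalIntegral.integral_mono_on hab.le (Continuous.intervalIntegrable (by fun_prop) _ _)
      (by simp) fun x hx => ?_
    rw [← hcm]
    exact sq_sub_le_mul_integral_deriv_sq hg hg' hx ⟨hc.1.le, hc.2.le⟩
  rw [intervalIntegral.integral_const, smul_eq_mul, h1] at h2
  have h3 : ∫ x in a..b, g x = m * (b - a) := by rw [hm]; field_simp
  have h4 : (b - a)⁻¹ * (∫ x in a..b, g x) ^ 2 = m ^ 2 * (b - a) := by
    rw [h3]; field_simp
  rw [h4]
  rw [h3] at h2
  nlinarith

/-- Friedrichs' inequality on an interval with an equidistant partition. -/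
theorem integral_sq_le_of_partition {g g' : ℝ → ℝ} (hg : ∀ x, HasDerivAt g (g' x) x)
    (hg' : Continuous g') {a : ℕ → ℝ} {h : ℝ} (hh : 0 < h) (ha : ∀ i, a (i + 1) = a i + h)
    (N : ℕ) :
    ∫ x in a 0..a N, g x ^ 2 ≤ h ^ 2 * (∫ x in a 0..a N, g' x ^ 2)
      + h⁻¹ * ∑ i ∈ Finset.range N, (∫ x in a i..a (i + 1), g x) ^ 2 := by
  have hgc : Continuous g := continuous_iff_continuousAt.2 fun x => (hg x).continuousAt
  rw [← intervalIntegral.sum_integral_adjacent_intervals (f := fun x => g x ^ 2) fun i _ =>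
    Continuous.intervalIntegrable (by fun_prop) _ _,
    ← intervalIntegral.sum_integral_adjacent_intervals (f := fun x => g' x ^ 2) fun i _ =>
    Continuous.intervalIntegrable (by fun_prop) _ _, Finset.mul_sum, Finset.mul_sum,
    ← Finset.sum_add_distrib]
  refine Finset.sum_le_sum fun i _ => ?_
  have := integral_sq_le_of_interval hg hg' (a := a i) (b := a (i + 1)) (by rw [ha]; linarith)
  rwa [ha, add_sub_cancel_left, ← ha] at this

theorem continuous_intervalIntegral_fst {F : ℝ × ℝ → ℝ} (hF : Continuous F) (a b : ℝ) :
    Continuous fun y => ∫ x in a..b, F (x, y) :=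
  intervalIntegral.continuous_parametric_intervalIntegral_of_continuous' (μ := volume)
    (f := fun y x => F (x, y)) (by fun_prop) a b

theorem hasDerivAt_intervalIntegral_fst {F : ℝ × ℝ → ℝ} (hF : ContDiff ℝ 1 F)
    (hFs : HasCompactSupport F) (a b y : ℝ) :
    HasDerivAt (fun y => ∫ x in a..b, F (x, y)) (∫ x in a..b, fderiv ℝ F (x, y) (0, 1)) y := by
  have hc := hF.continuous
  have hc' : Continuous fun p => fderiv ℝ F p (0, 1) :=
    (hF.continuous_fderiv one_ne_zero).clm_apply continuous_const
  have hs : HasCompactSupport fun p => fderiv ℝ F p (0, 1) := hFs.fderiv_apply ℝ (0, 1)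
  obtain ⟨M, hM⟩ := hs.exists_bound_of_continuous hc'
  refine (intervalIntegral.hasDerivAt_integral_of_dominated_loc_of_deriv_le
    (F := fun y x => F (x, y)) (F' := fun y x => fderiv ℝ F (x, y) (0, 1)) (bound := fun _ => M)
    (s := Set.univ) univ_mem (Eventually.of_forall fun y => ?_) ?_ ?_ ?_ (by simp) ?_).2
  · exact Continuous.aestronglyMeasurable (by fun_prop)
  · exact Continuous.intervalIntegrable (by fun_prop) _ _
  · exact Continuous.aestronglyMeasurable (hc'.comp (by fun_prop))
  · exact Eventually.of_forall fun x _ y _ => hM _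
  · refine Eventually.of_forall fun x _ y _ => ?_
    have h1 : HasFDerivAt F (fderiv ℝ F (x, y)) (x, y) :=
      (hF.differentiable one_ne_zero _).hasFDerivAt
    exact h1.comp_hasDerivAt y ((hasDerivAt_const y x).prodMk (hasDerivAt_id y))

theorem hasDerivAt_fst {F : ℝ × ℝ → ℝ} (hF : ContDiff ℝ 1 F) (x y : ℝ) :
    HasDerivAt (fun x => F (x, y)) (fderiv ℝ F (x, y) (1, 0)) x := by
  have h1 : HasFDerivAt F (fderiv ℝ F (x, y)) (x, y) :=
    (hF.differentiable one_ne_zero _).hasFDerivAt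
  exact h1.comp_hasDerivAt x ((hasDerivAt_id x).prodMk (hasDerivAt_const x y))

/-- Friedrichs' inequality on a square divided into squares of side `h`. -/
theorem integral_sq_le_of_grid {F : ℝ × ℝ → ℝ} (hF : ContDiff ℝ 1 F)
    (hFs : HasCompactSupport F) {a : ℕ → ℝ} {h : ℝ} (hh : 0 < h)
    (ha : ∀ i, a (i + 1) = a i + h) (N : ℕ) :
    ∫ y in a 0..a N, ∫ x in a 0..a N, F (x, y) ^ 2 ≤
      h ^ 2 * (∫ y in a 0..a N, ∫ x in a 0..a N,
        ((fderiv ℝ F (x, y) (1, 0)) ^ 2 + (fderiv ℝ F (x, y) (0, 1)) ^ 2))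
      + (h⁻¹) ^ 2 * ∑ i ∈ Finset.range N, ∑ j ∈ Finset.range N,
        (∫ y in a j..a (j + 1), ∫ x in a i..a (i + 1), F (x, y)) ^ 2 := by
  have hc := hF.continuous
  have hcx : Continuous fun p => fderiv ℝ F p (1, 0) :=
    (hF.continuous_fderiv one_ne_zero).clm_apply continuous_const
  have hcy : Continuous fun p => fderiv ℝ F p (0, 1) :=
    (hF.continuous_fderiv one_ne_zero).clm_apply continuous_const
  have hmono : Monotone a := monotone_nat_of_le_succ fun i => by rw [ha]; linarith
  have h0N : a 0 ≤ a N := hmono (Nat.zero_le _)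
  set G : ℕ → ℝ → ℝ := fun i y => ∫ x in a i..a (i + 1), F (x, y) with hG
  have hGc : ∀ i, Continuous (G i) := fun i => continuous_intervalIntegral_fst hc _ _
  have hF2 : Continuous fun p => F p ^ 2 := by fun_prop
  have hFx2 : Continuous fun p => (fderiv ℝ F p (1, 0)) ^ 2 := by fun_prop
  have hFy2 : Continuous fun p => (fderiv ℝ F p (0, 1)) ^ 2 := by fun_prop
  have cF2 := continuous_intervalIntegral_fst hF2
  have cFx2 := continuous_intervalIntegral_fst hFx2
  have cFy2 := continuous_intervalIntegral_fst hFy2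
  have step1 : ∫ y in a 0..a N, ∫ x in a 0..a N, F (x, y) ^ 2 ≤
      h ^ 2 * (∫ y in a 0..a N, ∫ x in a 0..a N, (fderiv ℝ F (x, y) (1, 0)) ^ 2)
        + h⁻¹ * ∑ i ∈ Finset.range N, ∫ y in a 0..a N, G i y ^ 2 := by
    rw [← intervalIntegral.integral_finsetSum (f := fun i y => G i y ^ 2) fun i _ =>
        ((hGc i).pow 2).intervalIntegrable _ _,
      ← intervalIntegral.integral_const_mul, ← intervalIntegral.integral_const_mul,
      ← intervalIntegral.integral_add]
    · refine intervalIntegral.integral_mono_on h0N ((cF2 _ _).intervalIntegrable _ _)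
        (Continuous.intervalIntegrable ?_ _ _) fun y _ => ?_
      · exact ((cFx2 _ _).const_mul _).add
          ((continuous_finsetSum _ fun i _ => (hGc i).pow 2).const_mul _)
      · exact integral_sq_le_of_partition (g := fun x => F (x, y)) (hasDerivAt_fst hF · y)
          (hcx.comp (by fun_prop)) hh ha N
    · exact ((cFx2 _ _).const_mul _).intervalIntegrable _ _
    · exact ((continuous_finsetSum _ fun i _ => (hGc i).pow 2).const_mul _).intervalIntegrable _ _
  -- The strip integrals `G i` are again functions of one variable, so the partition inequality
  -- applies a second time. The extra factor h comes from Cauchy-Schwarz across a strip of width h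
  -- and cancels the h⁻¹ of `step1`.
  have step2 : ∀ i, ∫ y in a 0..a N, G i y ^ 2 ≤
      h ^ 2 * (h * ∫ y in a 0..a N, ∫ x in a i..a (i + 1), (fderiv ℝ F (x, y) (0, 1)) ^ 2)
        + h⁻¹ * ∑ j ∈ Finset.range N, (∫ y in a j..a (j + 1), G i y) ^ 2 := by
    intro i
    have hGd := continuous_intervalIntegral_fst hcy (a i) (a (i + 1))
    refine (integral_sq_le_of_partition (g := G i)
      (fun y => hasDerivAt_intervalIntegral_fst hF hFs _ _ y) hGd hh ha N).trans ?_
    gcongr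
    rw [← intervalIntegral.integral_const_mul]
    refine intervalIntegral.integral_mono_on h0N ((hGd.pow 2).intervalIntegrable _ _)
      (((cFy2 _ _).const_mul _).intervalIntegrable _ _) fun y _ => ?_
    have := sq_intervalIntegral_le (g := fun x => fderiv ℝ F (x, y) (0, 1))
      (hcy.comp (by fun_prop)) (hmono (Nat.le_succ i))
    rwa [Nat.succ_eq_add_one, ha, add_sub_cancel_left, ← ha] at this
  have step3 : ∑ i ∈ Finset.range N,
      ∫ y in a 0..a N, ∫ x in a i..a (i + 1), (fderiv ℝ F (x, y) (0, 1)) ^ 2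
      = ∫ y in a 0..a N, ∫ x in a 0..a N, (fderiv ℝ F (x, y) (0, 1)) ^ 2 := by
    rw [← intervalIntegral.integral_finsetSum fun i _ => (cFy2 _ _).intervalIntegrable _ _]
    congr 1
    ext y
    exact intervalIntegral.sum_integral_adjacent_intervals fun i _ =>
      (hFy2.comp (by fun_prop : Continuous fun x => (x, y))).intervalIntegrable _ _
  have step4 : ∫ y in a 0..a N, ∫ x in a 0..a N,
        ((fderiv ℝ F (x, y) (1, 0)) ^ 2 + (fderiv ℝ F (x, y) (0, 1)) ^ 2)
      = (∫ y in a 0..a N, ∫ x in a 0..a N, (fderiv ℝ F (x, y) (1, 0)) ^ 2)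
        + ∫ y in a 0..a N, ∫ x in a 0..a N, (fderiv ℝ F (x, y) (0, 1)) ^ 2 := by
    rw [← intervalIntegral.integral_add ((cFx2 _ _).intervalIntegrable _ _)
      ((cFy2 _ _).intervalIntegrable _ _)]
    congr 1
    ext y
    exact intervalIntegral.integral_add
      ((hFx2.comp (by fun_prop : Continuous fun x => (x, y))).intervalIntegrable _ _)
      ((hFy2.comp (by fun_prop : Continuous fun x => (x, y))).intervalIntegrable _ _)
  rw [step4]
  refine step1.trans ?_
  have step5 := Finset.sum_le_sum fun i (_ : i ∈ Finset.range N) => step2 i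
  rw [Finset.sum_add_distrib, ← Finset.mul_sum, ← Finset.mul_sum, ← Finset.mul_sum, step3] at step5
  have := mul_le_mul_of_nonneg_left step5 (inv_pos.2 hh).le
  refine (add_le_add_right this _).trans (le_of_eq ?_)
  field_simp
  ring

/-- Integrate (g²)' = 2gg' over (b, ∞); compact support removes the boundary value at infinity. -/
theorem sq_le_two_mul_integral_abs_mul_deriv {g : ℝ → ℝ} (hg : ContDiff ℝ 1 g)
    (hgs : HasCompactSupport g) (b : ℝ) : g b ^ 2 ≤ 2 * ∫ s, |g s * deriv g s| := by
  have h2 : ContDiff ℝ 1 fun s => g s ^ 2 := hg.pow 2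
  have hs2 : HasCompactSupport fun s => g s ^ 2 :=
    hgs.comp_left (g := fun r : ℝ => r ^ 2) (by simp)
  have hd : ∀ s, deriv (fun s => g s ^ 2) s = 2 * (g s * deriv g s) := fun s => by
    rw [deriv_fun_pow (hg.differentiable one_ne_zero s)]; simp; ring
  have hint : Integrable fun s => |g s * deriv g s| :=
    ((hg.continuous.mul (hg.continuous_deriv le_rfl)).integrable_of_hasCompactSupport
      hgs.mul_right).abs
  have h := hs2.integral_Ioi_deriv_eq h2 b
  calc g b ^ 2 = -∫ s in Set.Ioi b, deriv (fun s => g s ^ 2) s := by rw [h, neg_neg]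
    _ ≤ |∫ s in Set.Ioi b, deriv (fun s => g s ^ 2) s| := neg_le_abs _
    _ ≤ ∫ s in Set.Ioi b, |deriv (fun s => g s ^ 2) s| := abs_integral_le_integral_abs
    _ = ∫ s in Set.Ioi b, 2 * |g s * deriv g s| := by
        simp_rw [hd, abs_mul (2 : ℝ), abs_two]
    _ ≤ ∫ s, 2 * |g s * deriv g s| := setIntegral_le_integral (hint.const_mul 2)
        (Eventually.of_forall fun s => by positivity)
    _ = _ := integral_const_mul _ _

/-- The trace inequality on a graph. -/
theorem integral_sq_graph_le {F : ℝ × ℝ → ℝ} (hF : ContDiff ℝ 1 F) (hFs : HasCompactSupport F)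
    {ψ : ℝ → ℝ} (hψ : Continuous ψ) :
    Integrable (fun t => F (t, ψ t) ^ 2) ∧
    ∫ t, F (t, ψ t) ^ 2 ≤
      2 * (√(∫ p, F p ^ 2) * √(∫ p, (fderiv ℝ F p (0, 1)) ^ 2)) := by
  have hc := hF.continuous
  have hcy : Continuous fun p => fderiv ℝ F p (0, 1) :=
    (hF.continuous_fderiv one_ne_zero).clm_apply continuous_const
  have hsy : HasCompactSupport fun p => fderiv ℝ F p (0, 1) := hFs.fderiv_apply ℝ (0, 1)
  have hsl : ∀ t, HasCompactSupport fun s => F (t, s) := fun t =>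
    HasCompactSupport.intro (hFs.isCompact.image continuous_snd) fun s hs => by
      by_contra hne
      exact hs ⟨(t, s), subset_tsupport _ hne, rfl⟩
  have hint : Integrable fun p : ℝ × ℝ => |F p * fderiv ℝ F p (0, 1)| :=
    ((hc.mul hcy).integrable_of_hasCompactSupport hFs.mul_right).abs
  have hgs : HasCompactSupport fun t => F (t, ψ t) ^ 2 :=
    HasCompactSupport.intro (hFs.isCompact.image continuous_fst) fun t ht => by
      by_contra hne
      exact ht ⟨(t, ψ t), subset_tsupport _ (by intro h0; simp [h0] at hne), rfl⟩
  have hgi : Integrable fun t => F (t, ψ t) ^ 2 :=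
    Continuous.integrable_of_hasCompactSupport (by fun_prop) hgs
  have hd : ∀ t s, deriv (fun s => F (t, s)) s = fderiv ℝ F (t, s) (0, 1) := fun t s =>
    (((hF.differentiable one_ne_zero (t, s)).hasFDerivAt).comp_hasDerivAt s
      ((hasDerivAt_const s t).prodMk (hasDerivAt_id s))).deriv
  refine ⟨hgi, ?_⟩
  -- On each vertical line the one-dimensional bound holds at every height, in particular at ψ(t).
  -- The slope of ψ therefore does not enter, and Fubini and Cauchy-Schwarz finish.
  calc ∫ t, F (t, ψ t) ^ 2 ≤ ∫ t, 2 * ∫ s, |F (t, s) * fderiv ℝ F (t, s) (0, 1)| := by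
        refine integral_mono hgi (hint.integral_prod_left.const_mul 2) fun t => ?_
        have := sq_le_two_mul_integral_abs_mul_deriv (g := fun s => F (t, s))
          (hF.comp (by fun_prop)) (hsl t) (ψ t)
        simp_rw [hd] at this
        exact this
    _ = 2 * ∫ p : ℝ × ℝ, |F p * fderiv ℝ F p (0, 1)| := by
        rw [integral_const_mul, Measure.volume_eq_prod, integral_prod _ hint]
    _ ≤ _ := by
        gcongr
        rw [← Real.sqrt_mul (integral_nonneg fun p => sq_nonneg _)]
        apply Real.le_sqrt_of_sq_le
        have := sq_integral_mul_le (μ := (volume : Measure (ℝ × ℝ)))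
          (hc.memLp_of_hasCompactSupport hFs).abs
          (hcy.memLp_of_hasCompactSupport hsy).abs
        simpa only [Pi.abs_apply, sq_abs, ← abs_mul] using this

/-! ### Orthonormal coordinates in the plane -/

/-- The parametrization of the plane by the orthonormal coordinates `y ↦ (e y 0, e y 1)`. -/
def coordMap (e : Plane ≃ₗᵢ[ℝ] Plane) : ℝ × ℝ →L[ℝ] Plane :=
  (ContinuousLinearMap.fst ℝ ℝ ℝ).smulRight (e.symm (EuclideanSpace.single 0 1))
    + (ContinuousLinearMap.snd ℝ ℝ ℝ).smulRight (e.symm (EuclideanSpace.single 1 1))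

theorem coordMap_apply (e : Plane ≃ₗᵢ[ℝ] Plane) (p : ℝ × ℝ) :
    coordMap e p = e.symm (WithLp.toLp 2 ![p.1, p.2]) := by
  have : (WithLp.toLp 2 ![p.1, p.2] : Plane)
      = p.1 • EuclideanSpace.single 0 1 + p.2 • EuclideanSpace.single 1 1 := by
    ext i
    fin_cases i <;> simp
  rw [this, map_add, map_smul, map_smul]
  rfl

@[simp]
theorem apply_coordMap_zero (e : Plane ≃ₗᵢ[ℝ] Plane) (p : ℝ × ℝ) : e (coordMap e p) 0 = p.1 := by
  simp [coordMap_apply]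

@[simp]
theorem apply_coordMap_one (e : Plane ≃ₗᵢ[ℝ] Plane) (p : ℝ × ℝ) : e (coordMap e p) 1 = p.2 := by
  simp [coordMap_apply]

@[simp]
theorem coordMap_coords (e : Plane ≃ₗᵢ[ℝ] Plane) (y : Plane) : coordMap e (e y 0, e y 1) = y := by
  rw [coordMap_apply, LinearIsometryEquiv.symm_apply_eq]
  ext i
  fin_cases i <;> simp

theorem coordMap_injective (e : Plane ≃ₗᵢ[ℝ] Plane) : Function.Injective (coordMap e) :=
  fun p q h => Prod.ext (by simpa using congrArg (fun y => e y 0) h)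
    (by simpa using congrArg (fun y => e y 1) h)

theorem measurePreserving_coordMap (e : Plane ≃ₗᵢ[ℝ] Plane) :
    MeasurePreserving (coordMap e) volume volume := by
  have h := (e.symm.measurePreserving).comp ((PiLp.volume_preserving_toLp (Fin 2)).comp
    (volume_preserving_finTwoArrow ℝ).symm)
  convert! h using 1
  ext1 p
  rw [coordMap_apply]
  rfl

theorem measurableEmbedding_coordMap (e : Plane ≃ₗᵢ[ℝ] Plane) :
    MeasurableEmbedding (coordMap e) :=
  (coordMap e).continuous.measurableEmbedding (coordMap_injective e)

theorem integral_comp_coordMap (e : Plane ≃ₗᵢ[ℝ] Plane) (f : Plane → ℝ) :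
    ∫ p, f (coordMap e p) = ∫ y, f y :=
  (measurePreserving_coordMap e).integral_comp (measurableEmbedding_coordMap e) f

section Coordinates

variable {φ : Plane → ℝ} (hφ : ContDiff ℝ 1 φ) (hs : HasCompactSupport φ) (e : Plane ≃ₗᵢ[ℝ] Plane)

include hφ in
theorem contDiff_comp_coordMap : ContDiff ℝ 1 fun p => φ (coordMap e p) :=
  hφ.comp (coordMap e).contDiff

include hs in
theorem hasCompactSupport_comp_coordMap : HasCompactSupport fun p => φ (coordMap e p) := by
  have hcont : Continuous fun y : Plane => ((e y 0, e y 1) : ℝ × ℝ) := by fun_prop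
  refine HasCompactSupport.intro (hs.isCompact.image hcont) fun p hp => ?_
  by_contra hne
  exact hp ⟨coordMap e p, subset_tsupport _ hne, by simp⟩

include hφ in
theorem abs_fderiv_comp_coordMap_le (p v : ℝ × ℝ) (hv : ‖coordMap e v‖ ≤ 1) :
    (fderiv ℝ (fun p => φ (coordMap e p)) p v) ^ 2 ≤ ‖∇ φ (coordMap e p)‖ ^ 2 := by
  have h1 : fderiv ℝ (fun p => φ (coordMap e p)) p
      = (fderiv ℝ φ (coordMap e p)).comp (coordMap e) :=
    (((hφ.differentiable one_ne_zero _).hasFDerivAt).comp p (coordMap e).hasFDerivAt).fderiv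
  have h2 : ‖∇ φ (coordMap e p)‖ = ‖fderiv ℝ φ (coordMap e p)‖ :=
    LinearIsometryEquiv.norm_map _ _
  rw [h1, h2, ← sq_abs]
  gcongr
  refine ((fderiv ℝ φ (coordMap e p)).le_opNorm (coordMap e v)).trans ?_
  exact mul_le_of_le_one_right (norm_nonneg _) hv

theorem norm_coordMap_zero_one : ‖coordMap e (0, 1)‖ ≤ 1 := by
  simp [coordMap]

theorem norm_coordMap_one_zero : ‖coordMap e (1, 0)‖ ≤ 1 := by
  simp [coordMap]

include hφ hs in
theorem integrable_norm_gradient_sq : Integrable fun y => ‖∇ φ y‖ ^ 2 := by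
  have hc : Continuous (fun x => ∇ φ x) :=
    (InnerProductSpace.toDual ℝ Plane).symm.continuous.comp (hφ.continuous_fderiv one_ne_zero)
  have hs' : HasCompactSupport (fun x => ∇ φ x) :=
    (hs.fderiv ℝ).comp_left (g := (InnerProductSpace.toDual ℝ Plane).symm) (map_zero _)
  exact Continuous.integrable_of_hasCompactSupport (by fun_prop)
    (hs'.comp_left (g := fun v => ‖v‖ ^ 2) (by simp))

include hφ hs in
theorem integral_fderiv_comp_coordMap_sq_le (v : ℝ × ℝ) (hv : ‖coordMap e v‖ ≤ 1) :
    Integrable (fun p => (fderiv ℝ (fun p => φ (coordMap e p)) p v) ^ 2) ∧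
    ∫ p, (fderiv ℝ (fun p => φ (coordMap e p)) p v) ^ 2 ≤ ∫ y, ‖∇ φ y‖ ^ 2 := by
  have hF := contDiff_comp_coordMap hφ e
  have hFs := hasCompactSupport_comp_coordMap hs e
  have hc : Continuous fun p => fderiv ℝ (fun p => φ (coordMap e p)) p v :=
    (hF.continuous_fderiv one_ne_zero).clm_apply continuous_const
  have hi : Integrable (fun p => (fderiv ℝ (fun p => φ (coordMap e p)) p v) ^ 2) :=
    Continuous.integrable_of_hasCompactSupport (by fun_prop)
      ((hFs.fderiv_apply ℝ v).comp_left (g := fun r : ℝ => r ^ 2) (by simp))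
  refine ⟨hi, ?_⟩
  rw [← integral_comp_coordMap e fun y => ‖∇ φ y‖ ^ 2]
  refine integral_mono hi ?_ fun p => abs_fderiv_comp_coordMap_le hφ e p v hv
  exact (measurePreserving_coordMap e).integrable_comp_of_integrable
    (integrable_norm_gradient_sq hφ hs)

include hφ hs in
/-- The trace inequality on a graph in orthonormal coordinates. -/
theorem integral_sq_coordMap_graph_le {ψ : ℝ → ℝ} (hψ : Continuous ψ) :
    Integrable (fun t => φ (coordMap e (t, ψ t)) ^ 2) ∧
    ∫ t, φ (coordMap e (t, ψ t)) ^ 2 ≤ 2 * (√(∫ y, φ y ^ 2) * √(∫ y, ‖∇ φ y‖ ^ 2)) := by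
  obtain ⟨h1, h2⟩ := integral_sq_graph_le (contDiff_comp_coordMap hφ e)
    (hasCompactSupport_comp_coordMap hs e) hψ
  refine ⟨h1, h2.trans ?_⟩
  rw [integral_comp_coordMap e fun y => φ y ^ 2]
  gcongr
  exact (integral_fderiv_comp_coordMap_sq_le hφ hs e _ (norm_coordMap_zero_one e)).2

end Coordinates

/-! ### Poincaré and Friedrichs inequalities in the plane -/

theorem iterated_intervalIntegral_eq {G : ℝ × ℝ → ℝ} (hG : Integrable G) {a b c d : ℝ}
    (hab : a ≤ b) (hcd : c ≤ d) :
    ∫ y in c..d, ∫ x in a..b, G (x, y) = ∫ p in Set.Ioc a b ×ˢ Set.Ioc c d, G p := by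
  have h : Integrable G ((volume.restrict (Set.Ioc a b)).prod (volume.restrict (Set.Ioc c d))) := by
    rw [Measure.prod_restrict, ← Measure.volume_eq_prod]
    exact hG.integrableOn
  rw [Measure.volume_eq_prod, ← Measure.prod_restrict, integral_prod_symm _ h,
    intervalIntegral.integral_of_le hcd]
  simp_rw [intervalIntegral.integral_of_le hab]

theorem abs_coord_lt {R : ℝ} {y : Plane} (hy : ‖y‖ < R) : |y 0| < R ∧ |y 1| < R :=
  ⟨(PiLp.norm_apply_le y 0).trans_lt hy, (PiLp.norm_apply_le y 1).trans_lt hy⟩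

/-- Poincaré's inequality for functions supported in a ball. -/
theorem integral_sq_le_integral_gradient_sq {φ : Plane → ℝ} (hφ : ContDiff ℝ 1 φ)
    (hs : HasCompactSupport φ) {R : ℝ} (hR : 0 < R) (hφR : ∀ y, φ y ≠ 0 → ‖y‖ < R) :
    ∫ y, φ y ^ 2 ≤ (4 * R) ^ 2 * ∫ y, ‖∇ φ y‖ ^ 2 := by
  set e := LinearIsometryEquiv.refl ℝ Plane
  set A := ∫ y, φ y ^ 2 with hA
  set B := ∫ y, ‖∇ φ y‖ ^ 2 with hB
  have hA0 : 0 ≤ A := integral_nonneg fun y => sq_nonneg _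
  have hB0 : 0 ≤ B := integral_nonneg fun y => sq_nonneg _
  have hc := (contDiff_comp_coordMap hφ e).continuous
  have hint : Integrable fun p => φ (coordMap e p) ^ 2 :=
    Continuous.integrable_of_hasCompactSupport (by fun_prop)
      ((hasCompactSupport_comp_coordMap hs e).comp_left (g := fun r : ℝ => r ^ 2) (by simp))
  -- The graph inequality applied to the horizontal lines at heights s ∈ (-R, R], then integrated in
  -- s. Dividing by √A gives the claim.
  have h1 : A ≤ 2 * R * (2 * (√A * √B)) := by
    have hbd : ∀ s, ∫ t, φ (coordMap e (t, s)) ^ 2 ≤ 2 * (√A * √B) := fun s =>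
      (integral_sq_coordMap_graph_le hφ hs e (continuous_const (y := s))).2
    have hsl : ∀ s ∉ Set.Ioc (-R) R, ∫ t, φ (coordMap e (t, s)) ^ 2 = 0 := by
      intro s hsR
      have : ∀ t, φ (coordMap e (t, s)) ^ 2 = 0 := fun t => by
        by_contra hne
        have h := (abs_lt.1 (abs_coord_lt (hφR (coordMap e (t, s)) (by intro h0; simp [h0] at hne))).2)
        have h' : (coordMap e (t, s)) 1 = s := apply_coordMap_one e (t, s)
        rw [h'] at h
        exact hsR ⟨h.1, h.2.le⟩
      simp [this]
    calc A = ∫ p, φ (coordMap e p) ^ 2 := (integral_comp_coordMap e fun y => φ y ^ 2).symm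
      _ = ∫ s, ∫ t, φ (coordMap e (t, s)) ^ 2 := by
          rw [Measure.volume_eq_prod, integral_prod_symm _ hint]
      _ = ∫ s in Set.Ioc (-R) R, ∫ t, φ (coordMap e (t, s)) ^ 2 :=
          (setIntegral_eq_integral_of_forall_compl_eq_zero hsl).symm
      _ ≤ ∫ _ in Set.Ioc (-R) R, 2 * (√A * √B) :=
          integral_mono hint.integral_prod_right.integrableOn
            (integrableOn_const (by simp)) hbd
      _ = 2 * R * (2 * (√A * √B)) := by
          rw [setIntegral_const, smul_eq_mul, Measure.real, Real.volume_Ioc,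
            ENNReal.toReal_ofReal (by linarith)]
          ring
  rcases hA0.eq_or_lt with h0 | hpos
  · rw [← h0]; positivity
  have h2 : √A ≤ 4 * R * √B := by
    have hsA : 0 < √A := Real.sqrt_pos.2 hpos
    have : √A * √A ≤ √A * (4 * R * √B) := by
      rw [Real.mul_self_sqrt hA0]; linarith
    exact le_of_mul_le_mul_left this hsA
  calc A = √A ^ 2 := (Real.sq_sqrt hA0).symm
    _ ≤ (4 * R * √B) ^ 2 := by gcongr
    _ = (4 * R) ^ 2 * B := by rw [mul_pow, Real.sq_sqrt hB0]

/-- Friedrichs' inequality for functions supported in a ball: up to a small multiple of the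
gradient, the `L²` norm is controlled by finitely many means. -/
theorem exists_friedrichs {R : ℝ} (hR : 0 < R) {ε : ℝ} (hε : 0 < ε) :
    ∃ (C : ℝ) (N : ℕ) (Q : ℕ → ℕ → Set Plane), 0 ≤ C ∧
      (∀ i j, MeasurableSet (Q i j) ∧ volume (Q i j) ≠ ∞) ∧
      ∀ φ : Plane → ℝ, ContDiff ℝ 1 φ → HasCompactSupport φ → (∀ y, φ y ≠ 0 → ‖y‖ < R) →
        ∫ y, φ y ^ 2 ≤ ε * (∫ y, ‖∇ φ y‖ ^ 2)
          + C * ∑ i ∈ Finset.range N, ∑ j ∈ Finset.range N, (∫ y in Q i j, φ y) ^ 2 := by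
  set e := LinearIsometryEquiv.refl ℝ Plane
  -- The cell side h = 2R/N satisfies 2h² ≤ ε: the grid inequality carries the factor h², and each
  -- of the two partial derivatives costs at most one full ∫‖∇φ‖². The cells depend only on R and ε,
  -- not on φ.
  obtain ⟨N, hN⟩ := exists_nat_gt (2 * R / √(ε / 2))
  have hNpos : (0 : ℝ) < N := lt_of_le_of_lt (by positivity) hN
  set h : ℝ := 2 * R / N with hh
  have hhpos : 0 < h := by positivity
  set a : ℕ → ℝ := fun i => -R + i * h with ha
  have ha0 : a 0 = -R := by simp [ha]
  have haN : a N = R := by simp only [ha, hh]; field_simp; ring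
  have has : ∀ i, a (i + 1) = a i + h := fun i => by simp only [ha]; push_cast; ring
  have hle : ∀ i, a i ≤ a (i + 1) := fun i => by rw [has]; linarith
  have hh2 : 2 * h ^ 2 ≤ ε := by
    have h1 : h ≤ √(ε / 2) := by
      rw [hh, div_le_iff₀ hNpos]
      rw [div_lt_iff₀ (by positivity)] at hN
      linarith
    have := (Real.le_sqrt hhpos.le (by positivity)).1 h1
    linarith
  set S : ℕ → ℕ → Set (ℝ × ℝ) :=
    fun i j => Set.Ioc (a i) (a (i + 1)) ×ˢ Set.Ioc (a j) (a (j + 1)) with hS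
  have hSm : ∀ i j, MeasurableSet (S i j) := fun i j => measurableSet_Ioc.prod measurableSet_Ioc
  refine ⟨(h⁻¹) ^ 2, N, fun i j => coordMap e '' S i j, by positivity, fun i j => ⟨?_, ?_⟩,
    fun φ hφ hs hφR => ?_⟩
  · exact (measurableEmbedding_coordMap e).measurableSet_image.2 (hSm i j)
  · rw [← (measurePreserving_coordMap e).map_eq, (measurableEmbedding_coordMap e).map_apply,
      Set.preimage_image_eq _ (coordMap_injective e), Measure.volume_eq_prod, Measure.prod_prod]
    exact ENNReal.mul_ne_top (by simp) (by simp)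
  have hF := contDiff_comp_coordMap hφ e
  have hFs := hasCompactSupport_comp_coordMap hs e
  have hc := hF.continuous
  have key := integral_sq_le_of_grid hF hFs hhpos has N
  rw [ha0, haN] at key
  obtain ⟨ix, bx⟩ := integral_fderiv_comp_coordMap_sq_le hφ hs e (1, 0) (norm_coordMap_one_zero e)
  obtain ⟨iy, bY⟩ := integral_fderiv_comp_coordMap_sq_le hφ hs e (0, 1) (norm_coordMap_zero_one e)
  have hi2 : Integrable fun p => φ (coordMap e p) ^ 2 :=
    Continuous.integrable_of_hasCompactSupport (by fun_prop)
      (hFs.comp_left (g := fun r : ℝ => r ^ 2) (by simp))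
  have hRR : -R ≤ R := by linarith
  have hiF : Integrable fun p => φ (coordMap e p) := hc.integrable_of_hasCompactSupport hFs
  have hiG := ix.add iy
  have h1 : ∫ y, φ y ^ 2 = ∫ y in (-R)..R, ∫ x in (-R)..R, φ (coordMap e (x, y)) ^ 2 := by
    rw [iterated_intervalIntegral_eq hi2 hRR hRR, ← integral_comp_coordMap e fun y => φ y ^ 2]
    refine (setIntegral_eq_integral_of_forall_compl_eq_zero fun p hp => ?_).symm
    by_contra hne
    have h := abs_coord_lt (hφR (coordMap e p) (by intro h0; simp [h0] at hne))
    rw [show coordMap e p 0 = p.1 from apply_coordMap_zero e p,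
      show coordMap e p 1 = p.2 from apply_coordMap_one e p, abs_lt, abs_lt] at h
    exact hp ⟨⟨h.1.1, h.1.2.le⟩, ⟨h.2.1, h.2.2.le⟩⟩
  have h2 : (∫ y in (-R)..R, ∫ x in (-R)..R,
      ((fderiv ℝ (fun p => φ (coordMap e p)) (x, y) (1, 0)) ^ 2
        + (fderiv ℝ (fun p => φ (coordMap e p)) (x, y) (0, 1)) ^ 2))
      ≤ 2 * ∫ y, ‖∇ φ y‖ ^ 2 := by
    have h3 := iterated_intervalIntegral_eq hiG hRR hRR
    simp only [Pi.add_apply] at h3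
    rw [h3]
    refine (setIntegral_le_integral hiG (Eventually.of_forall fun p => ?_)).trans ?_
    · simp only [Pi.add_apply, Pi.zero_apply]; positivity
    · simp only [Pi.add_apply]
      rw [integral_add ix iy]
      linarith
  have h4 : ∀ i j, ∫ y in coordMap e '' S i j, φ y
      = ∫ y in a j..a (j + 1), ∫ x in a i..a (i + 1), φ (coordMap e (x, y)) := fun i j => by
    rw [iterated_intervalIntegral_eq hiF (hle i) (hle j),
      ← (measurePreserving_coordMap e).setIntegral_preimage_emb (measurableEmbedding_coordMap e),
      Set.preimage_image_eq _ (coordMap_injective e)]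
  rw [h1]
  simp_rw [h4]
  refine key.trans ?_
  refine add_le_add_left ?_ _
  have hB : 0 ≤ ∫ y, ‖∇ φ y‖ ^ 2 := integral_nonneg fun y => sq_nonneg _
  refine (mul_le_mul_of_nonneg_left h2 (sq_nonneg h)).trans ?_
  rw [← mul_assoc, mul_comm (h ^ 2)]
  exact mul_le_mul_of_nonneg_right hh2 hB

/-! ### Lipschitz boundaries -/

/-- Near a boundary point, a Lipschitz boundary is a Lipschitz graph. -/
theorem HasLipschitzBoundary.exists_graph {D : Set Plane} (hD : HasLipschitzBoundary D)
    {x : Plane} (hx : x ∈ frontier D) :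
    ∃ (e : Plane ≃ₗᵢ[ℝ] Plane) (ψ : ℝ → ℝ) (K : ℝ≥0) (r : ℝ),
      LipschitzWith K ψ ∧ 0 < r ∧
        frontier D ∩ Metric.ball x r = {y | ψ (e y 0) = e y 1} ∩ Metric.ball x r := by
  obtain ⟨e, ψ, K, r, hψ, hr, h⟩ := hD x hx
  refine ⟨e, ψ, K, r, hψ, hr, ?_⟩
  have hψc := hψ.continuous
  rw [← frontier_inter_open_inter Metric.isOpen_ball, h, frontier_inter_open_inter Metric.isOpen_ball]
  congr 1
  refine Set.Subset.antisymm (frontier_lt_subset_eq (by fun_prop) (by fun_prop)) fun y hy => ?_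
  have hopen : IsOpen {y : Plane | ψ (e y 0) < e y 1} :=
    isOpen_lt (by fun_prop) (by fun_prop)
  rw [hopen.frontier_eq]
  refine ⟨?_, fun hlt => absurd hy (ne_of_lt hlt)⟩
  -- Raising a point of the graph by s > 0 moves it strictly above the graph, so it is a limit of
  -- points of the region.
  have hcont : Continuous fun s : ℝ => coordMap e (e y 0, e y 1 + s) := by fun_prop
  have ht : Tendsto (fun s : ℝ => coordMap e (e y 0, e y 1 + s)) (𝓝[>] 0) (𝓝 y) := by
    have := (hcont.tendsto 0).mono_left (nhdsWithin_le_nhds (s := Set.Ioi 0))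
    simpa using this
  refine mem_closure_of_tendsto ht ?_
  filter_upwards [self_mem_nhdsWithin] with s hs
  have hs' : (0 : ℝ) < s := hs
  have hy' : ψ (e y 0) = e y 1 := hy
  simp only [apply_coordMap_zero, apply_coordMap_one, hy']
  linarith

theorem exists_lipschitzWith_graph (e : Plane ≃ₗᵢ[ℝ] Plane) {ψ : ℝ → ℝ} {K : ℝ≥0}
    (hψ : LipschitzWith K ψ) : ∃ C : ℝ≥0, LipschitzWith C fun t => coordMap e (t, ψ t) :=
  ⟨_, (coordMap e).lipschitz.comp (LipschitzWith.id.prodMk hψ)⟩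

/-- A Lipschitz map increases one-dimensional Hausdorff measure at most by its constant. This
reduces arc length integrals of nonnegative functions to integrals over the parameter. -/
theorem hausdorffMeasure_restrict_le_map {γ : ℝ → Plane} {C : ℝ≥0} (hγ : LipschitzWith C γ)
    {S : Set Plane} (hS : S ⊆ Set.range γ) :
    (Measure.hausdorffMeasure 1 : Measure Plane).restrict S ≤ C • Measure.map γ volume := by
  refine Measure.le_iff.2 fun A hA => ?_
  rw [Measure.restrict_apply hA, Measure.smul_apply, Measure.map_apply hγ.continuous.measurable hA]
  have hsub : A ∩ S ⊆ γ '' (γ ⁻¹' A) := by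
    rintro y ⟨hyA, hyS⟩
    obtain ⟨t, rfl⟩ := hS hyS
    exact ⟨t, hyA, rfl⟩
  refine (measure_mono hsub).trans ((hγ.hausdorffMeasure_image_le zero_le_one _).trans ?_)
  rw [hausdorffMeasure_real, ENNReal.rpow_one]
  rfl

section Boundary

variable {D : Set Plane} (hD : HasLipschitzBoundary D) (hc : IsCompact (frontier D))

include hD in
theorem HasLipschitzBoundary.exists_local_lipschitz {x : Plane} (hx : x ∈ frontier D) :
    ∃ (e : Plane ≃ₗᵢ[ℝ] Plane) (ψ : ℝ → ℝ) (C : ℝ≥0) (r : ℝ), Continuous ψ ∧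
      LipschitzWith C (fun t => coordMap e (t, ψ t)) ∧ 0 < r ∧ ψ (e x 0) = e x 1 ∧
      (∀ t, coordMap e (t, ψ t) ∈ Metric.ball x r → coordMap e (t, ψ t) ∈ frontier D) ∧
      ∀ y ∈ frontier D ∩ Metric.ball x r, coordMap e (e y 0, ψ (e y 0)) = y := by
  obtain ⟨e, ψ, K, r, hψ, hr, h⟩ := hD.exists_graph hx
  obtain ⟨C, hC⟩ := exists_lipschitzWith_graph e hψ
  refine ⟨e, ψ, C, r, hψ.continuous, hC, hr, ?_, fun t ht => ?_, fun y hy => ?_⟩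
  · exact (h.subset ⟨hx, Metric.mem_ball_self hr⟩).1
  · exact (h.superset ⟨by simp, ht⟩).1
  · have : ψ (e y 0) = e y 1 := (h.subset hy).1
    rw [this, coordMap_coords]

include hD hc in
-- Near each of its points the boundary lies in the Lipschitz image of a bounded interval;
-- compactness makes the bound global.
theorem hausdorffMeasure_frontier_lt_top :
    (Measure.hausdorffMeasure 1 : Measure Plane) (frontier D) < ∞ := by
  refine hc.measure_lt_top_of_nhdsWithin fun x hx => ?_
  obtain ⟨e, ψ, C, r, -, hC, hr, -, -, hy⟩ := hD.exists_local_lipschitz hx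
  refine ⟨frontier D ∩ Metric.ball x r, inter_mem_nhdsWithin _ (Metric.ball_mem_nhds x hr), ?_⟩
  have hsub : frontier D ∩ Metric.ball x r ⊆
      (fun t => coordMap e (t, ψ t)) '' Metric.ball (e x 0) r := by
    intro y hyy
    refine ⟨e y 0, ?_, hy y hyy⟩
    rw [Metric.mem_ball, dist_eq_norm] at *
    calc ‖e y 0 - e x 0‖ = ‖(e (y - x)) 0‖ := by rw [map_sub]; rfl
      _ ≤ ‖e (y - x)‖ := PiLp.norm_apply_le _ _
      _ = ‖y - x‖ := e.norm_map _
      _ < r := by simpa [dist_eq_norm] using hyy.2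
  refine (measure_mono hsub).trans_lt ((hC.hausdorffMeasure_image_le zero_le_one _).trans_lt ?_)
  rw [hausdorffMeasure_real, ENNReal.rpow_one]
  exact ENNReal.mul_lt_top ENNReal.coe_lt_top measure_ball_lt_top

include hD hc in
-- Finite one-dimensional measure forces two-dimensional Hausdorff measure zero, and area is
-- absolutely continuous with respect to the latter.
theorem volume_frontier_eq_zero : volume (frontier D) = 0 := by
  have h2 : (Measure.hausdorffMeasure 2 : Measure Plane) (frontier D) = 0 :=
    (Measure.hausdorffMeasure_zero_or_top (by norm_num : (1 : ℝ) < 2) _).resolve_right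
      (hausdorffMeasure_frontier_lt_top hD hc).ne
  have hfr : Module.finrank ℝ Plane = 2 := by simp
  have : (volume : Measure Plane) ≪
      Measure.hausdorffMeasure (Module.finrank ℝ Plane : ℝ) :=
    Measure.absolutelyContinuous_isAddHaarMeasure _ _
  refine this ?_
  rw [hfr]
  exact_mod_cast h2

include hD in
-- The projection to the first local coordinate is 1-Lipschitz, and its image of this piece of the
-- boundary contains a nonempty open set of parameters.
theorem hausdorffMeasure_frontier_inter_ball_pos {x : Plane} (hx : x ∈ frontier D) {δ : ℝ}
    (hδ : 0 < δ) :
    0 < (Measure.hausdorffMeasure 1 : Measure Plane) (frontier D ∩ Metric.ball x δ) := by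
  obtain ⟨e, ψ, C, r, hψ, -, hr, hψx, hmem, -⟩ := hD.exists_local_lipschitz hx
  set U : Set ℝ := (fun t => coordMap e (t, ψ t)) ⁻¹' Metric.ball x (min r δ) with hU
  have hUo : IsOpen U := Metric.isOpen_ball.preimage (by fun_prop)
  have hxU : e x 0 ∈ U := by
    simp only [hU, Set.mem_preimage, hψx, coordMap_coords]
    exact Metric.mem_ball_self (lt_min hr hδ)
  have hlip : LipschitzWith 1 fun y : Plane => e y 0 := LipschitzWith.of_dist_le_mul fun y z => by
    rw [dist_eq_norm, dist_eq_norm, NNReal.coe_one, one_mul]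
    calc ‖e y 0 - e z 0‖ = ‖(e (y - z)) 0‖ := by rw [map_sub]; rfl
      _ ≤ ‖e (y - z)‖ := PiLp.norm_apply_le _ _
      _ = ‖y - z‖ := e.norm_map _
  have hsub : U ⊆ (fun y : Plane => e y 0) '' (frontier D ∩ Metric.ball x δ) := by
    intro t ht
    refine ⟨coordMap e (t, ψ t), ⟨hmem t ?_, ?_⟩, by simp⟩
    · exact Metric.ball_subset_ball (min_le_left _ _) ht
    · exact Metric.ball_subset_ball (min_le_right _ _) ht
  calc 0 < volume U := hUo.measure_pos _ ⟨_, hxU⟩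
    _ ≤ volume ((fun y : Plane => e y 0) '' (frontier D ∩ Metric.ball x δ)) := measure_mono hsub
    _ ≤ _ := by
        rw [← hausdorffMeasure_real]
        simpa using hlip.hausdorffMeasure_image_le zero_le_one (frontier D ∩ Metric.ball x δ)

include hD hc in
/-- The trace inequality on a compact Lipschitz boundary. -/
theorem exists_trace_inequality : ∃ C : ℝ≥0, ∀ φ : Plane → ℝ, ContDiff ℝ 1 φ →
    HasCompactSupport φ →
      ∫⁻ y in frontier D, ENNReal.ofReal (φ y ^ 2) ∂(Measure.hausdorffMeasure 1) ≤
        C * ENNReal.ofReal (√(∫ y, φ y ^ 2) * √(∫ y, ‖∇ φ y‖ ^ 2)) := by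
  -- The property passes to subsets and finite unions, so by compactness it suffices to have it near
  -- each boundary point. No partition of unity is needed, since the graph inequality holds for all
  -- of φ.
  refine hc.induction_on (p := fun S => ∃ C : ℝ≥0, ∀ φ : Plane → ℝ, ContDiff ℝ 1 φ →
    HasCompactSupport φ → ∫⁻ y in S, ENNReal.ofReal (φ y ^ 2) ∂(Measure.hausdorffMeasure 1) ≤
        C * ENNReal.ofReal (√(∫ y, φ y ^ 2) * √(∫ y, ‖∇ φ y‖ ^ 2))) ?_ ?_ ?_ ?_
  · exact ⟨0, fun φ _ _ => by simp⟩
  · rintro S T hST ⟨C, hC⟩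
    exact ⟨C, fun φ h1 h2 => (lintegral_mono_set hST).trans (hC φ h1 h2)⟩
  · rintro S T ⟨C, hC⟩ ⟨C', hC'⟩
    refine ⟨C + C', fun φ h1 h2 => (lintegral_union_le _ _ _).trans ?_⟩
    rw [ENNReal.coe_add, add_mul]
    exact add_le_add (hC φ h1 h2) (hC' φ h1 h2)
  · intro x hx
    obtain ⟨e, ψ, C, r, hψ, hC, hr, -, -, hy⟩ := hD.exists_local_lipschitz hx
    refine ⟨_, inter_mem_nhdsWithin _ (Metric.ball_mem_nhds x hr), C * 2, fun φ h1 h2 => ?_⟩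
    have hle := hausdorffMeasure_restrict_le_map hC
      (S := frontier D ∩ Metric.ball x r) fun y hyy => ⟨e y 0, hy y hyy⟩
    obtain ⟨hi, hb⟩ := integral_sq_coordMap_graph_le h1 h2 e hψ
    refine (lintegral_mono' hle le_rfl).trans ?_
    have hm : Measurable fun y => ENNReal.ofReal (φ y ^ 2) :=
      (h1.continuous.measurable.pow_const 2).ennreal_ofReal
    rw [lintegral_smul_measure, lintegral_map hm hC.continuous.measurable,
      ← ofReal_integral_eq_lintegral_ofReal hi (Eventually.of_forall fun t => sq_nonneg _)]
    rw [ENNReal.coe_mul, mul_assoc]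
    refine mul_le_mul_right ?_ _
    refine (ENNReal.ofReal_le_ofReal hb).trans ?_
    rw [ENNReal.ofReal_mul zero_le_two]
    simp

end Boundary

/-! ### The space `H₀¹(Ω)`, its embedding into `L²(Ω)` and the trace operator -/

theorem norm_sq_Lp_eq_integral {X E : Type*} [MeasurableSpace X] {μ : Measure X}
    [NormedAddCommGroup E] [InnerProductSpace ℝ E] (f : Lp E 2 μ) :
    ‖f‖ ^ 2 = ∫ x, ‖f x‖ ^ 2 ∂μ := by
  rw [← real_inner_self_eq_norm_sq, L2.inner_def]
  simp_rw [real_inner_self_eq_norm_sq]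

theorem norm_sq_toLp_eq_integral {X E : Type*} [MeasurableSpace X] {μ : Measure X}
    [NormedAddCommGroup E] [InnerProductSpace ℝ E] {f : X → E} (hf : MemLp f 2 μ) :
    ‖hf.toLp f‖ ^ 2 = ∫ x, ‖f x‖ ^ 2 ∂μ := by
  rw [norm_sq_Lp_eq_integral]
  refine integral_congr_ae ?_
  filter_upwards [hf.coeFn_toLp] with x hx
  rw [hx]

theorem inner_Lp_eq_integral_mul {X : Type*} [MeasurableSpace X] {μ : Measure X}
    (f g : Lp ℝ 2 μ) : inner ℝ f g = ∫ x, f x * g x ∂μ := by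
  rw [L2.inner_def]
  simp [mul_comm]

variable {Ω : Opens Plane}

/-- Test functions as elements of `H₀¹(Ω)`. -/
def ofTest (Ω : Opens Plane) : 𝓓(Ω, ℝ) →ₗ[ℝ] H10 Ω :=
  (testPair Ω).codRestrict _ fun φ =>
    Submodule.le_topologicalClosure _ (LinearMap.mem_range_self _ φ)

theorem denseRange_ofTest : DenseRange (ofTest Ω) := by
  intro u
  rw [Metric.mem_closure_iff]
  intro ε hε
  obtain ⟨_, ⟨φ, rfl⟩, hd⟩ := Metric.mem_closure_iff.1
    (show (u : L2Pair Ω) ∈ closure (LinearMap.range (testPair Ω) : Set (L2Pair Ω)) from u.2) ε hε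
  exact ⟨ofTest Ω φ, ⟨φ, rfl⟩, hd⟩

instance : CompleteSpace (H10 Ω) :=
  (Submodule.isClosed_topologicalClosure (LinearMap.range (testPair Ω))).completeSpace_coe

/-- The embedding `H₀¹(Ω) → L²(Ω)`. -/
def fnL (Ω : Opens Plane) : H10 Ω →L[ℝ] Lp ℝ 2 (area Ω) :=
  (WithLp.fstL 2 ℝ _ _).comp (H10 Ω).subtypeL

/-- The gradient `H₀¹(Ω) → L²(Ω; ℝ²)`. -/
def gradL (Ω : Opens Plane) : H10 Ω →L[ℝ] Lp Plane 2 (area Ω) :=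
  (WithLp.sndL 2 ℝ _ _).comp (H10 Ω).subtypeL

theorem fn_eq (u : H10 Ω) : fn u = fnL Ω u := rfl

theorem grad_eq (u : H10 Ω) : grad u = gradL Ω u := rfl

theorem norm_sq_eq (u : H10 Ω) : ‖u‖ ^ 2 = ‖fnL Ω u‖ ^ 2 + ‖gradL Ω u‖ ^ 2 :=
  WithLp.prod_norm_sq_eq_of_L2 (u : L2Pair Ω)

theorem norm_fnL_le (u : H10 Ω) : ‖fnL Ω u‖ ≤ ‖u‖ := by
  have := norm_sq_eq u
  nlinarith [sq_nonneg ‖gradL Ω u‖, norm_nonneg u, norm_nonneg (fnL Ω u)]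

theorem norm_gradL_le (u : H10 Ω) : ‖gradL Ω u‖ ≤ ‖u‖ := by
  have := norm_sq_eq u
  nlinarith [sq_nonneg ‖fnL Ω u‖, norm_nonneg u, norm_nonneg (gradL Ω u)]

theorem fnL_ofTest (φ : 𝓓(Ω, ℝ)) : fnL Ω (ofTest Ω φ) = (memLp_test φ).toLp _ := rfl

theorem gradL_ofTest (φ : 𝓓(Ω, ℝ)) :
    gradL Ω (ofTest Ω φ) = (memLp_gradient_test φ).toLp _ := rfl

theorem test_eq_zero (φ : 𝓓(Ω, ℝ)) {x : Plane} (hx : x ∉ (Ω : Set Plane)) : φ x = 0 :=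
  image_eq_zero_of_notMem_tsupport fun h => hx (φ.tsupport_subset h)

theorem gradient_test_eq_zero (φ : 𝓓(Ω, ℝ)) {x : Plane} (hx : x ∉ (Ω : Set Plane)) :
    ∇ (φ : Plane → ℝ) x = 0 := by
  have : fderiv ℝ (φ : Plane → ℝ) x = 0 :=
    fderiv_of_notMem_tsupport ℝ fun h => hx (φ.tsupport_subset h)
  rw [gradient, this, map_zero]

theorem norm_sq_fnL_ofTest (φ : 𝓓(Ω, ℝ)) : ‖fnL Ω (ofTest Ω φ)‖ ^ 2 = ∫ x, φ x ^ 2 := by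
  rw [fnL_ofTest, norm_sq_toLp_eq_integral]
  simp_rw [Real.norm_eq_abs, sq_abs]
  exact setIntegral_eq_integral_of_forall_compl_eq_zero fun x hx => by simp [test_eq_zero φ hx]

theorem norm_sq_gradL_ofTest (φ : 𝓓(Ω, ℝ)) :
    ‖gradL Ω (ofTest Ω φ)‖ ^ 2 = ∫ x, ‖∇ (φ : Plane → ℝ) x‖ ^ 2 := by
  rw [gradL_ofTest, norm_sq_toLp_eq_integral]
  exact setIntegral_eq_integral_of_forall_compl_eq_zero fun x hx => by
    simp [gradient_test_eq_zero φ hx]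

theorem contDiff_one_test (φ : 𝓓(Ω, ℝ)) : ContDiff ℝ 1 φ := φ.contDiff.of_le (by simp)

/-- Poincaré's inequality in `H₀¹(Ω)`. -/
theorem norm_fnL_sq_le {R : ℝ} (hR : 0 < R) (hΩ : (Ω : Set Plane) ⊆ Metric.ball 0 R)
    (u : H10 Ω) : ‖fnL Ω u‖ ^ 2 ≤ (4 * R) ^ 2 * ‖gradL Ω u‖ ^ 2 := by
  refine denseRange_ofTest.induction_on
    (p := fun u : H10 Ω => ‖fnL Ω u‖ ^ 2 ≤ (4 * R) ^ 2 * ‖gradL Ω u‖ ^ 2) u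
    (isClosed_le (by fun_prop) (by fun_prop)) fun φ => ?_
  rw [norm_sq_fnL_ofTest, norm_sq_gradL_ofTest]
  refine integral_sq_le_integral_gradient_sq (contDiff_one_test φ) φ.hasCompactSupport hR
    fun y hy => ?_
  by_contra hcon
  exact hy (test_eq_zero φ fun h => hcon (by simpa using hΩ h))

/-- Square root of the Friedrichs estimate, in the linear form that the compactness criterion
requires. Here s is a sum over N² cells and y the largest cell integral in absolute value. -/
theorem le_add_of_sq_le {x ε g U C s y N : ℝ} (hε : 0 ≤ ε) (hC : 0 ≤ C) (hx : 0 ≤ x)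
    (hg : 0 ≤ g) (hgU : g ≤ U) (hy : 0 ≤ y) (h : x ^ 2 ≤ ε ^ 2 * g ^ 2 + C * s)
    (hs : s ≤ N ^ 2 * y ^ 2) : x ≤ ε * U + √(C * N ^ 2) * y := by
  have hU : 0 ≤ U := hg.trans hgU
  have h2 : C * s ≤ C * (N ^ 2 * y ^ 2) := mul_le_mul_of_nonneg_left hs hC
  have h3 : ε ^ 2 * g ^ 2 ≤ ε ^ 2 * U ^ 2 := by gcongr
  have h4 : √(C * N ^ 2) ^ 2 = C * N ^ 2 := Real.sq_sqrt (by positivity)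
  have h5 : 0 ≤ 2 * (ε * U) * (√(C * N ^ 2) * y) := by positivity
  refine (sq_le_sq₀ hx (by positivity)).1 ?_
  rw [add_sq, mul_pow, mul_pow, h4]
  linarith

/-- Rellich's theorem: the embedding `H₀¹(Ω) → L²(Ω)` is compact. -/
theorem totallyBounded_fnL {R : ℝ} (hR : 0 < R) (hΩ : (Ω : Set Plane) ⊆ Metric.ball 0 R) :
    TotallyBounded (fnL Ω '' Metric.closedBall 0 1) := by
  refine totallyBounded_image_of_norm_le _ fun ε hε => ?_
  obtain ⟨C, N, Q, hC, hQ, hF⟩ := exists_friedrichs hR (sq_pos_of_pos hε)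
  have hQΩ : ∀ i j, area Ω (Q i j) ≠ ∞ := fun i j =>
    ne_top_of_le_ne_top (hQ i j).2 (Measure.restrict_apply_le _ _)
  -- Integrals over cells, written as inner products with indicators so that they are bounded
  -- functionals. Together they form a map into a finite-dimensional space, where the image of the
  -- unit ball is totally bounded.
  set ℓ : ℕ → ℕ → H10 Ω →L[ℝ] ℝ := fun i j =>
    (innerSL ℝ (indicatorConstLp 2 (hQ i j).1 (hQΩ i j) (1 : ℝ))).comp (fnL Ω) with hℓ
  have hℓa : ∀ i j u, ℓ i j u = ∫ x in Q i j, fnL Ω u x ∂(area Ω) := fun i j u =>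
    L2.inner_indicatorConstLp_one (hQ i j).1 (hQΩ i j) (fnL Ω u)
  have hmain : ∀ u, ‖fnL Ω u‖ ^ 2 ≤ ε ^ 2 * ‖gradL Ω u‖ ^ 2
      + C * ∑ i ∈ Finset.range N, ∑ j ∈ Finset.range N, ℓ i j u ^ 2 := by
    intro u
    refine denseRange_ofTest.induction_on (p := fun u : H10 Ω => ‖fnL Ω u‖ ^ 2 ≤
      ε ^ 2 * ‖gradL Ω u‖ ^ 2 + C * ∑ i ∈ Finset.range N, ∑ j ∈ Finset.range N, ℓ i j u ^ 2) u
      (isClosed_le (by fun_prop) (by fun_prop)) fun φ => ?_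
    rw [norm_sq_fnL_ofTest, norm_sq_gradL_ofTest]
    refine (hF φ (contDiff_one_test φ) φ.hasCompactSupport fun y hy => ?_).trans (le_of_eq ?_)
    · by_contra hcon
      exact hy (test_eq_zero φ fun h => hcon (by simpa using hΩ h))
    congr 2
    refine Finset.sum_congr rfl fun i _ => Finset.sum_congr rfl fun j _ => ?_
    rw [hℓa, fnL_ofTest]
    congr 1
    rw [Measure.restrict_restrict (hQ i j).1]
    have h1 : ∫ x in Q i j ∩ Ω, (memLp_test φ).toLp φ x = ∫ x in Q i j ∩ Ω, φ x := by
      refine integral_congr_ae ?_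
      exact ae_mono (Measure.restrict_mono_set _ Set.inter_subset_right)
        (memLp_test φ).coeFn_toLp
    rw [h1]
    exact (setIntegral_eq_of_subset_of_forall_sdiff_eq_zero (hQ i j).1 Set.inter_subset_left
      fun x hx => test_eq_zero φ fun h => hx.2 ⟨hx.1, h⟩)
  set S : H10 Ω →L[ℝ] (Fin N × Fin N → ℝ) :=
    ContinuousLinearMap.pi fun k => ℓ k.1 k.2 with hS
  refine ⟨Fin N × Fin N → ℝ, inferInstance, inferInstance, S, √(C * N ^ 2), ?_, fun u => ?_⟩
  · refine (isCompact_closedBall (0 : Fin N × Fin N → ℝ) ‖S‖).totallyBounded.subset ?_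
    rintro _ ⟨u, hu, rfl⟩
    rw [mem_closedBall_zero_iff] at hu ⊢
    exact (S.le_opNorm u).trans (mul_le_of_le_one_right (by positivity) hu)
  · have hsum : ∑ i ∈ Finset.range N, ∑ j ∈ Finset.range N, ℓ i j u ^ 2 ≤ N ^ 2 * ‖S u‖ ^ 2 := by
      have hb : ∀ i ∈ Finset.range N, ∀ j ∈ Finset.range N, ℓ i j u ^ 2 ≤ ‖S u‖ ^ 2 := by
        intro i hi j hj
        rw [← sq_abs]
        have := norm_le_pi_norm (S u) (⟨i, Finset.mem_range.1 hi⟩, ⟨j, Finset.mem_range.1 hj⟩)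
        gcongr
        exact this
      calc _ ≤ ∑ _ ∈ Finset.range N, ∑ _ ∈ Finset.range N, ‖S u‖ ^ 2 :=
            Finset.sum_le_sum fun i hi => Finset.sum_le_sum fun j hj => hb i hi j hj
        _ = _ := by simp; ring
    exact le_add_of_sq_le hε.le hC (norm_nonneg _) (norm_nonneg _) (norm_gradL_le u)
      (norm_nonneg _) (hmain u) hsum

/-! ### The trace operator on Γ -/

section Trace

variable (Ω₁ : Opens Plane) [IsFiniteMeasure (arc Ω₁)]

theorem memLp_test_arc (φ : 𝓓(Ω, ℝ)) : MemLp φ 2 (arc Ω₁) :=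
  φ.continuous.memLp_of_hasCompactSupport φ.hasCompactSupport

/-- The restriction of test functions to `Γ`. -/
def restrTest (Ω Ω₁ : Opens Plane) [IsFiniteMeasure (arc Ω₁)] : 𝓓(Ω, ℝ) →ₗ[ℝ] Lp ℝ 2 (arc Ω₁) where
  toFun φ := (memLp_test_arc Ω₁ φ).toLp φ
  map_add' φ χ := MemLp.toLp_add (memLp_test_arc Ω₁ φ) (memLp_test_arc Ω₁ χ)
  map_smul' c φ := MemLp.toLp_const_smul c (memLp_test_arc Ω₁ φ)

/-- The trace operator `H₀¹(Ω) → L²(Γ)`. -/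
def traceL (Ω Ω₁ : Opens Plane) [IsFiniteMeasure (arc Ω₁)] : H10 Ω →L[ℝ] Lp ℝ 2 (arc Ω₁) :=
  (restrTest Ω Ω₁).extendOfNorm (ofTest Ω)

variable {Ω₁} {C : ℝ} (hC0 : 0 ≤ C) (hC : ∀ φ : 𝓓(Ω, ℝ), ‖restrTest Ω Ω₁ φ‖ ^ 2 ≤
  C * (‖fnL Ω (ofTest Ω φ)‖ * ‖gradL Ω (ofTest Ω φ)‖))

include hC0 hC in
theorem norm_restrTest_le (φ : 𝓓(Ω, ℝ)) : ‖restrTest Ω Ω₁ φ‖ ≤ √C * ‖ofTest Ω φ‖ := by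
  rw [← Real.sqrt_sq (norm_nonneg (ofTest Ω φ)), ← Real.sqrt_mul hC0]
  apply Real.le_sqrt_of_sq_le
  refine (hC φ).trans ?_
  rw [sq]
  gcongr
  exacts [norm_fnL_le _, norm_gradL_le _]

include hC0 hC in
theorem traceL_ofTest (φ : 𝓓(Ω, ℝ)) : traceL Ω Ω₁ (ofTest Ω φ) = restrTest Ω Ω₁ φ :=
  LinearMap.extendOfNorm_eq denseRange_ofTest ⟨√C, norm_restrTest_le hC0 hC⟩ φ

include hC0 hC in
theorem norm_traceL_sq_le (u : H10 Ω) :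
    ‖traceL Ω Ω₁ u‖ ^ 2 ≤ C * (‖fnL Ω u‖ * ‖gradL Ω u‖) := by
  refine denseRange_ofTest.induction_on (p := fun u : H10 Ω =>
    ‖traceL Ω Ω₁ u‖ ^ 2 ≤ C * (‖fnL Ω u‖ * ‖gradL Ω u‖)) u
    (isClosed_le (by fun_prop) (by fun_prop)) fun φ => ?_
  rw [traceL_ofTest hC0 hC]
  exact hC φ

include hC0 hC in
-- The product form of the trace inequality is decisive: C‖u‖₀‖u‖ = (ε‖u‖)(C/ε ‖u‖₀), where ‖u‖ is
-- the H¹ norm, is at most the square of the sum of the two factors. Rellich's theorem for the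
-- embedding thus carries over to the trace.
theorem totallyBounded_traceL (hfn : TotallyBounded (fnL Ω '' Metric.closedBall 0 1)) :
    TotallyBounded (traceL Ω Ω₁ '' Metric.closedBall 0 1) := by
  refine totallyBounded_image_of_norm_le _ fun ε hε => ?_
  refine ⟨Lp ℝ 2 (area Ω), inferInstance, inferInstance, fnL Ω, C / ε, hfn, fun u => ?_⟩
  have h1 : C * (‖fnL Ω u‖ * ‖gradL Ω u‖) ≤ C * (‖fnL Ω u‖ * ‖u‖) := by
    gcongr
    exact norm_gradL_le u
  have h2 : 0 ≤ C / ε * ‖fnL Ω u‖ := by positivity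
  refine (sq_le_sq₀ (norm_nonneg _) (by positivity)).1 ?_
  calc ‖traceL Ω Ω₁ u‖ ^ 2 ≤ C * (‖fnL Ω u‖ * ‖u‖) := (norm_traceL_sq_le hC0 hC u).trans h1
    _ = (ε * ‖u‖) * (C / ε * ‖fnL Ω u‖) := by field_simp
    _ ≤ _ := by nlinarith [mul_nonneg hε.le (norm_nonneg u)]

include hC0 hC in
theorem isTrace_traceL (u : H10 Ω) : IsTrace Ω₁ u (traceL Ω Ω₁ u) := by
  refine ⟨Lp.memLp _, ?_⟩
  obtain ⟨v, hv, hvu⟩ := mem_closure_iff_seq_limit.1 (denseRange_ofTest u)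
  choose φ hφ using hv
  refine ⟨φ, ?_, ?_⟩
  · have := (continuous_subtype_val.tendsto u).comp hvu
    refine this.congr fun n => ?_
    rw [Function.comp_apply, ← hφ n]
    rfl
  · have h1 : Tendsto (fun n => restrTest Ω Ω₁ (φ n)) atTop (𝓝 (traceL Ω Ω₁ u)) := by
      refine (((traceL Ω Ω₁).continuous.tendsto u).comp hvu).congr fun n => ?_
      rw [Function.comp_apply, ← hφ n, traceL_ofTest hC0 hC]
    rw [Lp.tendsto_Lp_iff_tendsto_eLpNorm'] at h1
    refine h1.congr fun n => eLpNorm_congr_ae ?_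
    filter_upwards [(memLp_test_arc Ω₁ (φ n)).coeFn_toLp] with x hx
    simp only [Pi.sub_apply]
    exact congrArg (· - _) hx

include hC0 hC in
-- Restriction to Γ is continuous in the H¹ norm, so the limit does not depend on the approximating
-- test functions. The arbitrary choice in `trace` is therefore harmless.
theorem IsTrace.ae_eq_traceL {u : H10 Ω} {τ : Plane → ℝ} (h : IsTrace Ω₁ u τ) :
    τ =ᵐ[arc Ω₁] traceL Ω Ω₁ u := by
  obtain ⟨hτ, φ, hφ, hφτ⟩ := h
  have h1 : Tendsto (fun n => restrTest Ω Ω₁ (φ n)) atTop (𝓝 (hτ.toLp τ)) :=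
    (Lp.tendsto_Lp_iff_tendsto_eLpNorm'' _ (fun n => memLp_test_arc Ω₁ (φ n)) _ hτ).2 hφτ
  have h2 : Tendsto (fun n => restrTest Ω Ω₁ (φ n)) atTop (𝓝 (traceL Ω Ω₁ u)) := by
    have : Tendsto (fun n => ofTest Ω (φ n)) atTop (𝓝 u) := tendsto_subtype_rng.2 hφ
    refine (((traceL Ω Ω₁).continuous.tendsto u).comp this).congr fun n => ?_
    rw [Function.comp_apply, traceL_ofTest hC0 hC]
  rw [← tendsto_nhds_unique h1 h2]
  exact hτ.coeFn_toLp.symm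

include hC0 hC in
theorem trace_ae_eq (u : H10 Ω) : trace Ω₁ u =ᵐ[arc Ω₁] traceL Ω Ω₁ u := by
  have h : ∃ τ, IsTrace Ω₁ u τ := ⟨_, isTrace_traceL hC0 hC u⟩
  have : IsTrace Ω₁ u (trace Ω₁ u) := by
    rw [trace, dif_pos h]
    exact h.choose_spec
  exact this.ae_eq_traceL hC0 hC

include hC0 hC in
theorem arcPairing_eq (g : Plane → ℝ) (v : H10 Ω) :
    arcPairing Ω₁ g v = ∫ x, g x * traceL Ω Ω₁ v x ∂(arc Ω₁) :=
  integral_congr_ae <| (trace_ae_eq hC0 hC v).mono fun x hx => by simp only [hx]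

include hC0 hC in
theorem arcPairing_trace_eq (w v : H10 Ω) :
    arcPairing Ω₁ (trace Ω₁ w) v = inner ℝ (traceL Ω Ω₁ w) (traceL Ω Ω₁ v) := by
  rw [arcPairing_eq hC0 hC, inner_Lp_eq_integral_mul]
  exact integral_congr_ae <| (trace_ae_eq hC0 hC w).mono fun x hx => by simp only [hx]

end Trace

theorem pairing_fn_eq (w v : H10 Ω) :
    pairing (fn w) v = inner ℝ (fnL Ω w) (fnL Ω v) :=
  (inner_Lp_eq_integral_mul _ _).symm

/-! ### The energy form -/

theorem inner_toLp_eq_integral {X E : Type*} [MeasurableSpace X] {μ : Measure X}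
    [NormedAddCommGroup E] [InnerProductSpace ℝ E] {f g : X → E} (hf : MemLp f 2 μ)
    (hg : MemLp g 2 μ) : inner ℝ (hf.toLp f) (hg.toLp g) = ∫ x, inner ℝ (f x) (g x) ∂μ := by
  rw [L2.inner_def]
  refine integral_congr_ae ?_
  filter_upwards [hf.coeFn_toLp, hg.coeFn_toLp] with x h1 h2
  rw [h1, h2]

theorem integral_inner_le {X E : Type*} [MeasurableSpace X] {μ : Measure X}
    [NormedAddCommGroup E] [InnerProductSpace ℝ E] {f g : X → E} (hf : MemLp f 2 μ)
    (hg : MemLp g 2 μ) : ∫ x, inner ℝ (f x) (g x) ∂μ ≤ ‖hf.toLp f‖ * ‖hg.toLp g‖ := by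
  rw [← inner_toLp_eq_integral hf hg]
  exact real_inner_le_norm _ _

theorem integral_mul_le {X : Type*} [MeasurableSpace X] {μ : Measure X} {f g : X → ℝ}
    (hf : MemLp f 2 μ) (hg : MemLp g 2 μ) :
    ∫ x, f x * g x ∂μ ≤ ‖hf.toLp f‖ * ‖hg.toLp g‖ := by
  have := integral_inner_le hf hg
  simpa [mul_comm] using this

theorem integrable_inner_of_memLp {X E : Type*} [MeasurableSpace X] {μ : Measure X}
    [NormedAddCommGroup E] [InnerProductSpace ℝ E] {f g : X → E} (hf : MemLp f 2 μ)
    (hg : MemLp g 2 μ) : Integrable (fun x => (inner ℝ (f x) (g x) : ℝ)) μ := by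
  refine (L2.integrable_inner (𝕜 := ℝ) (hf.toLp f) (hg.toLp g)).congr ?_
  filter_upwards [hf.coeFn_toLp, hg.coeFn_toLp] with x h1 h2
  rw [h1, h2]

section Form

variable {α β : Plane → ℝ} {a₀ a₁ b₁ : ℝ}
  (hαm : AEStronglyMeasurable α (area Ω)) (hα : ∀ᵐ x ∂(area Ω), a₀ ≤ α x ∧ α x ≤ a₁)
  (ha₀ : 0 < a₀)
  (hβm : AEStronglyMeasurable β (area Ω)) (hβ : ∀ᵐ x ∂(area Ω), 0 ≤ β x ∧ β x ≤ b₁)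

include hαm hα ha₀ in
theorem integrable_form_grad (u v : H10 Ω) :
    Integrable (fun x => α x * inner ℝ (grad u x) (grad v x)) (area Ω) :=
  (L2.integrable_inner (𝕜 := ℝ) (gradL Ω u) (gradL Ω v)).bdd_mul (c := a₁) hαm
    (hα.mono fun x hx => by
      rw [Real.norm_of_nonneg (ha₀.le.trans hx.1)]
      exact hx.2)

include hβm hβ in
theorem integrable_form_fn (u v : H10 Ω) :
    Integrable (fun x => β x * fn u x * fn v x) (area Ω) := by
  have h : Integrable (fun x => fn u x * fn v x) (area Ω) :=
    (Lp.memLp (fnL Ω u)).integrable_mul (Lp.memLp (fnL Ω v))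
  refine (h.bdd_mul (c := b₁) hβm (hβ.mono fun x hx => ?_)).congr
    (Eventually.of_forall fun x => (mul_assoc _ _ _).symm)
  rw [Real.norm_of_nonneg hx.1]
  exact hx.2

theorem form_symm (u v : H10 Ω) : form α β u v = form α β v u :=
  integral_congr_ae <| Eventually.of_forall fun x => by
    simp only [real_inner_comm (grad u x) (grad v x)]
    ring

include hαm hα ha₀ hβm hβ in
theorem integrable_form (u v : H10 Ω) :
    Integrable (fun x => α x * inner ℝ (grad u x) (grad v x) + β x * fn u x * fn v x) (area Ω) :=
  (integrable_form_grad hαm hα ha₀ u v).add (integrable_form_fn hβm hβ u v)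

include hαm hα ha₀ hβm hβ in
theorem form_add_left (u u' v : H10 Ω) : form α β (u + u') v = form α β u v + form α β u' v := by
  rw [form, form, form, ← integral_add (integrable_form hαm hα ha₀ hβm hβ u v)
    (integrable_form hαm hα ha₀ hβm hβ u' v)]
  refine integral_congr_ae ?_
  have h1 : fn (u + u') =ᵐ[area Ω] fn u + fn u' := by
    rw [fn_eq, map_add]; exact Lp.coeFn_add _ _
  have h2 : grad (u + u') =ᵐ[area Ω] grad u + grad u' := by
    rw [grad_eq, map_add]; exact Lp.coeFn_add _ _
  filter_upwards [h1, h2] with x h1 h2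
  rw [h1, h2, Pi.add_apply, Pi.add_apply, inner_add_left]
  ring

theorem form_smul_left (c : ℝ) (u v : H10 Ω) : form α β (c • u) v = c * form α β u v := by
  rw [form, form, ← integral_const_mul]
  refine integral_congr_ae ?_
  have h1 : fn (c • u) =ᵐ[area Ω] c • fn u := by
    rw [fn_eq, map_smul]; exact Lp.coeFn_smul _ _
  have h2 : grad (c • u) =ᵐ[area Ω] c • grad u := by
    rw [grad_eq, map_smul]; exact Lp.coeFn_smul _ _
  filter_upwards [h1, h2] with x h1 h2
  rw [h1, h2, Pi.smul_apply, Pi.smul_apply, real_inner_smul_left, smul_eq_mul]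
  ring

include hαm hα ha₀ hβm hβ in
theorem exists_bilinForm_eq_form :
    ∃ B : LinearMap.BilinForm ℝ (H10 Ω), ∀ u v, B u v = form α β u v :=
  ⟨LinearMap.mk₂ ℝ (form α β) (form_add_left hαm hα ha₀ hβm hβ) form_smul_left
    (fun u v v' => by
      rw [form_symm, form_add_left hαm hα ha₀ hβm hβ, form_symm v, form_symm v'])
    (fun c u v => by rw [form_symm, form_smul_left, form_symm v, smul_eq_mul]),
    fun _ _ => rfl⟩

include hαm hα ha₀ hβm hβ in
theorem form_self_eq (u : H10 Ω) : form α β u u =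
    (∫ x, α x * ‖grad u x‖ ^ 2 ∂(area Ω)) + ∫ x, β x * fn u x ^ 2 ∂(area Ω) := by
  rw [form, integral_add (integrable_form_grad hαm hα ha₀ u u) (integrable_form_fn hβm hβ u u)]
  simp_rw [real_inner_self_eq_norm_sq, sq, mul_assoc]

include hαm hα ha₀ hβm hβ in
theorem integral_coeff_grad_sq_le_form (u : H10 Ω) :
    ∫ x, α x * ‖grad u x‖ ^ 2 ∂(area Ω) ≤ form α β u u := by
  rw [form_self_eq hαm hα ha₀ hβm hβ]
  have : 0 ≤ ∫ x, β x * fn u x ^ 2 ∂(area Ω) :=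
    integral_nonneg_of_ae (hβ.mono fun x hx => mul_nonneg hx.1 (sq_nonneg _))
  linarith

include hαm hα ha₀ in
theorem integral_coeff_grad_sq_bounds (u : H10 Ω) :
    a₀ * ‖gradL Ω u‖ ^ 2 ≤ ∫ x, α x * ‖grad u x‖ ^ 2 ∂(area Ω) ∧
      ∫ x, α x * ‖grad u x‖ ^ 2 ∂(area Ω) ≤ a₁ * ‖gradL Ω u‖ ^ 2 := by
  have hi : Integrable (fun x => ‖gradL Ω u x‖ ^ 2) (area Ω) := by
    have := L2.integrable_inner (𝕜 := ℝ) (gradL Ω u) (gradL Ω u)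
    simpa only [real_inner_self_eq_norm_sq] using this
  have hi' : Integrable (fun x => α x * ‖grad u x‖ ^ 2) (area Ω) := by
    have := integrable_form_grad hαm hα ha₀ u u
    simpa only [real_inner_self_eq_norm_sq] using this
  rw [norm_sq_Lp_eq_integral, ← integral_const_mul, ← integral_const_mul]
  exact ⟨integral_mono_ae (hi.const_mul _) hi' (hα.mono fun x hx =>
      mul_le_mul_of_nonneg_right hx.1 (sq_nonneg _)),
    integral_mono_ae hi' (hi.const_mul _) (hα.mono fun x hx =>
      mul_le_mul_of_nonneg_right hx.2 (sq_nonneg _))⟩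

include hβm hβ in
theorem integral_mul_fn_sq_le (u : H10 Ω) :
    ∫ x, β x * fn u x ^ 2 ∂(area Ω) ≤ b₁ * ‖fnL Ω u‖ ^ 2 := by
  have hi : Integrable (fun x => ‖fnL Ω u x‖ ^ 2) (area Ω) := by
    have := L2.integrable_inner (𝕜 := ℝ) (fnL Ω u) (fnL Ω u)
    simpa only [real_inner_self_eq_norm_sq] using this
  have hi' : Integrable (fun x => β x * fn u x ^ 2) (area Ω) := by
    have := integrable_form_fn hβm hβ u u
    simpa only [mul_assoc, ← sq] using this
  rw [norm_sq_Lp_eq_integral, ← integral_const_mul]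
  refine integral_mono_ae hi' (hi.const_mul _) (hβ.mono fun x hx => ?_)
  simp only [Real.norm_eq_abs, sq_abs]
  exact mul_le_mul_of_nonneg_right hx.2 (sq_nonneg _)

include hαm hα ha₀ hβm hβ in
-- Coercivity: β ≥ 0 allows the zero order term to be dropped, and Poincaré's inequality gives ‖u‖²
-- ≤ ((4R)² + 1)‖∇u‖₀².
theorem le_form_self {R : ℝ} (hR : 0 < R) (hΩ : (Ω : Set Plane) ⊆ Metric.ball 0 R) (u : H10 Ω) :
    a₀ / ((4 * R) ^ 2 + 1) * ‖u‖ ^ 2 ≤ form α β u u := by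
  refine le_trans ?_ ((integral_coeff_grad_sq_bounds hαm hα ha₀ u).1.trans
    (integral_coeff_grad_sq_le_form hαm hα ha₀ hβm hβ u))
  rw [div_mul_eq_mul_div, div_le_iff₀ (by positivity), mul_assoc, norm_sq_eq]
  gcongr
  linarith [norm_fnL_sq_le hR hΩ u]

include hαm hα ha₀ hβm hβ in
theorem form_self_le (u : H10 Ω) : form α β u u ≤ (|a₁| + |b₁|) * ‖u‖ ^ 2 := by
  rw [form_self_eq hαm hα ha₀ hβm hβ, add_mul]
  refine add_le_add ((integral_coeff_grad_sq_bounds hαm hα ha₀ u).2.trans ?_)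
    ((integral_mul_fn_sq_le hβm hβ u).trans ?_)
  · gcongr
    exacts [le_abs_self _, norm_gradL_le u]
  · gcongr
    exacts [le_abs_self _, norm_fnL_le u]

end Form

/-! ### Nontriviality of the trace -/

/-- A bump centred at a point of Γ fits inside Ω because Γ ⊂ Ω. It equals 1 on a piece of Γ of
positive length. -/
theorem exists_traceL_ne_zero {Ω Ω₁ : Opens Plane} [IsFiniteMeasure (arc Ω₁)] {C : ℝ}
    (hC0 : 0 ≤ C) (hC : ∀ φ : 𝓓(Ω, ℝ), ‖restrTest Ω Ω₁ φ‖ ^ 2 ≤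
      C * (‖fnL Ω (ofTest Ω φ)‖ * ‖gradL Ω (ofTest Ω φ)‖))
    (hD : HasLipschitzBoundary (Ω₁ : Set Plane)) (hne : (frontier (Ω₁ : Set Plane)).Nonempty)
    (hΓ : frontier (Ω₁ : Set Plane) ⊆ Ω) : ∃ u : H10 Ω, traceL Ω Ω₁ u ≠ 0 := by
  obtain ⟨x, hx⟩ := hne
  obtain ⟨r, hr, hrΩ⟩ := Metric.isOpen_iff.1 Ω.isOpen x (hΓ hx)
  let b : ContDiffBump x := ⟨r / 4, r / 2, by positivity, by linarith⟩
  let φ : 𝓓(Ω, ℝ) := ⟨b, b.contDiff, b.hasCompactSupport, by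
    rw [b.tsupport_eq]
    exact (Metric.closedBall_subset_ball (by change r / 2 < r; linarith)).trans hrΩ⟩
  refine ⟨ofTest Ω φ, fun h0 => ?_⟩
  rw [traceL_ofTest hC0 hC] at h0
  have h1 : (φ : Plane → ℝ) =ᵐ[arc Ω₁] 0 := by
    refine (memLp_test_arc Ω₁ φ).coeFn_toLp.symm.trans ?_
    have h2 : (memLp_test_arc Ω₁ φ).toLp φ = 0 := h0
    rw [h2]
    exact Lp.coeFn_zero _ _ _
  have hpos := hausdorffMeasure_frontier_inter_ball_pos hD hx (show 0 < r / 4 by positivity)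
  have hz : arc Ω₁ (Metric.ball x (r / 4)) = 0 := by
    refine measure_mono_null (fun y hy => ?_) h1
    have : b y = 1 := b.one_of_mem_closedBall (Metric.ball_subset_closedBall hy)
    intro hy0
    have hy1 : b y = 0 := hy0
    rw [this] at hy1
    exact one_ne_zero hy1
  rw [Measure.restrict_apply measurableSet_ball, Set.inter_comm] at hz
  exact hpos.ne' hz

/-! ### The error estimate -/

theorem _root_.MeasureTheory.MemLp.two_add_measure {X E : Type*} [MeasurableSpace X]
    [NormedAddCommGroup E] {μ ν : Measure X} {f : X → E} (h1 : MemLp f 2 μ) (h2 : MemLp f 2 ν) :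
    MemLp f 2 (μ + ν) := by
  refine ⟨h1.1.add_measure h2.1, ?_⟩
  have k1 := h1.2
  have k2 := h2.2
  rw [eLpNorm_lt_top_iff_lintegral_rpow_enorm_lt_top (by simp) (by simp)] at *
  rw [lintegral_add_measure]
  exact ENNReal.add_lt_top.2 ⟨k1, k2⟩

theorem eLpNorm_eq_ofReal_norm {X E : Type*} [MeasurableSpace X] [NormedAddCommGroup E]
    {μ : Measure X} {f : X → E} (hf : MemLp f 2 μ) :
    eLpNorm f 2 μ = ENNReal.ofReal ‖hf.toLp f‖ := by
  rw [Lp.norm_toLp, ENNReal.ofReal_toReal hf.2.ne]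

/-- Cauchy-Schwarz in ℝ³ gives E² ≤ (A² + B² + H²)(f² + s² + t²), and the last factor is at most (1
+ 1/l + 1/m)E. Cancelling one E produces the constant of the theorem. -/
theorem sq_le_of_le_sum_mul {E A B H f s t l m : ℝ} (hl : 0 < l) (hm : 0 < m) (hE0 : 0 ≤ E)
    (hE : E ≤ A * f + B * s + H * t)
    (hf : l * f ^ 2 ≤ E) (hs : s ^ 2 ≤ E) (ht : m * t ^ 2 ≤ E) :
    E ≤ (1 + 1 / l + 1 / m) * (A ^ 2 + B ^ 2 + H ^ 2) := by
  rcases hE0.eq_or_lt with h0 | hpos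
  · rw [← h0]; positivity
  have hcs : (A * f + B * s + H * t) ^ 2 ≤ (A ^ 2 + B ^ 2 + H ^ 2) * (f ^ 2 + s ^ 2 + t ^ 2) := by
    nlinarith [sq_nonneg (A * s - B * f), sq_nonneg (A * t - H * f), sq_nonneg (B * t - H * s)]
  have hf' : f ^ 2 ≤ 1 / l * E := by
    rw [one_div, ← div_eq_inv_mul, le_div_iff₀ hl]; linarith
  have ht' : t ^ 2 ≤ 1 / m * E := by
    rw [one_div, ← div_eq_inv_mul, le_div_iff₀ hm]; linarith
  have hsum : f ^ 2 + s ^ 2 + t ^ 2 ≤ (1 + 1 / l + 1 / m) * E := by linarith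
  have h2 : E * E ≤ (1 + 1 / l + 1 / m) * (A ^ 2 + B ^ 2 + H ^ 2) * E := by
    calc E * E = E ^ 2 := (sq E).symm
      _ ≤ (A * f + B * s + H * t) ^ 2 := by gcongr
      _ ≤ _ := hcs
      _ ≤ (A ^ 2 + B ^ 2 + H ^ 2) * ((1 + 1 / l + 1 / m) * E) := by gcongr
      _ = _ := by ring
  exact le_of_mul_le_mul_right h2 hpos

variable {Ω₁ : Opens Plane}

/-- The two subdomains miss only points of Γ, a null set. -/
theorem area_eq_add (hsub : (Ω₁ : Set Plane) ⊆ Ω)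
    (hnull : volume (frontier (Ω₁ : Set Plane)) = 0) :
    area Ω = area Ω₁ + area (outer Ω Ω₁) := by
  have hdisj : Disjoint (Ω₁ : Set Plane) (outer Ω Ω₁ : Set Plane) :=
    Set.disjoint_left.2 fun x h1 h2 => h2.2 (subset_closure h1)
  have hmeas : MeasurableSet (outer Ω Ω₁ : Set Plane) := (outer Ω Ω₁).isOpen.measurableSet
  rw [area, area, area, ← Measure.restrict_union hdisj hmeas]
  refine Measure.restrict_congr_set ?_
  rw [ae_eq_set]
  refine ⟨measure_mono_null (fun x hx => ?_) hnull, ?_⟩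
  · rw [Ω₁.isOpen.frontier_eq]
    by_contra hcon
    exact hx.2 (by
      by_cases h1 : x ∈ (Ω₁ : Set Plane)
      · exact Or.inl h1
      · exact Or.inr ⟨hx.1, fun h2 => hcon ⟨h2, h1⟩⟩)
  · rw [Set.sdiff_eq_empty.2, measure_empty]
    exact Set.union_subset hsub fun x hx => hx.1

theorem memLp_weakDiv {D : Opens Plane} {p : Plane → Plane} (hp : p ∈ Hdiv D) :
    MemLp (weakDiv D p) 2 (area D) := by
  rw [weakDiv, dif_pos hp.2]
  exact hp.2.choose_spec.1

theorem pwDiv_eq_inner (p : Plane → Plane) {x : Plane} (hx : x ∈ (Ω₁ : Set Plane)) :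
    pwDiv Ω Ω₁ p x = weakDiv Ω₁ p x := by
  have : x ∉ (outer Ω Ω₁ : Set Plane) := fun h => h.2 (subset_closure hx)
  rw [pwDiv, Set.indicator_of_mem hx, Set.indicator_of_notMem this, add_zero]

theorem pwDiv_eq_outer (p : Plane → Plane) {x : Plane} (hx : x ∈ (outer Ω Ω₁ : Set Plane)) :
    pwDiv Ω Ω₁ p x = weakDiv (outer Ω Ω₁) p x := by
  have : x ∉ (Ω₁ : Set Plane) := fun h => hx.2 (subset_closure h)
  rw [pwDiv, Set.indicator_of_mem hx, Set.indicator_of_notMem this, zero_add]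

section Estimate

variable (hsplit : area Ω = area Ω₁ + area (outer Ω Ω₁)) {p : Plane → Plane}
  (hp : p ∈ Hdiv Ω₁ ∩ Hdiv (outer Ω Ω₁))

include hsplit hp in
theorem memLp_of_mem_Hdiv : MemLp p 2 (area Ω) := by
  rw [hsplit]
  exact hp.1.1.two_add_measure hp.2.1

include hsplit hp in
theorem memLp_pwDiv : MemLp (pwDiv Ω Ω₁ p) 2 (area Ω) := by
  rw [hsplit]
  refine MemLp.two_add_measure ((memLp_weakDiv hp.1).ae_eq ?_) ((memLp_weakDiv hp.2).ae_eq ?_)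
  · exact ae_restrict_of_forall_mem Ω₁.isOpen.measurableSet fun x hx => (pwDiv_eq_inner p hx).symm
  · exact ae_restrict_of_forall_mem (outer Ω Ω₁).isOpen.measurableSet
      fun x hx => (pwDiv_eq_outer p hx).symm

include hsplit hp in
/-- The jump of the normal component as an integral over `Ω`. -/
theorem normalJump_eq (v : H10 Ω) : normalJump Ω₁ p v =
    ∫ x, (inner ℝ (p x) (grad v x) + pwDiv Ω Ω₁ p x * fn v x) ∂(area Ω) := by
  have hint : Integrable (fun x => inner ℝ (p x) (grad v x) + pwDiv Ω Ω₁ p x * fn v x) (area Ω) :=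
    (integrable_inner_of_memLp (memLp_of_mem_Hdiv hsplit hp) (Lp.memLp (gradL Ω v))).add
      ((memLp_pwDiv hsplit hp).integrable_mul (Lp.memLp (fnL Ω v)))
  have h1 : normalTrace Ω₁ p v =
      ∫ x, (inner ℝ (p x) (grad v x) + pwDiv Ω Ω₁ p x * fn v x) ∂(area Ω₁) :=
    setIntegral_congr_fun Ω₁.isOpen.measurableSet fun x hx => by
      simp only [pwDiv_eq_inner p hx]
  have h2 : normalTrace (outer Ω Ω₁) p v =
      ∫ x, (inner ℝ (p x) (grad v x) + pwDiv Ω Ω₁ p x * fn v x) ∂(area (outer Ω Ω₁)) :=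
    setIntegral_congr_fun (outer Ω Ω₁).isOpen.measurableSet fun x hx => by
      simp only [pwDiv_eq_outer p hx]
  rw [hsplit] at hint
  rw [normalJump, sub_neg_eq_add, h1, h2, hsplit, integral_add_measure]
  · exact hint.mono_measure (Measure.le_add_right le_rfl)
  · exact hint.mono_measure (Measure.le_add_left le_rfl)

variable {α β : Plane → ℝ} {a₀ a₁ b₁ : ℝ}
  (hαm : AEStronglyMeasurable α (area Ω)) (hα : ∀ᵐ x ∂(area Ω), a₀ ≤ α x ∧ α x ≤ a₁)
  (ha₀ : 0 < a₀)
  (hβm : AEStronglyMeasurable β (area Ω)) (hβ : ∀ᵐ x ∂(area Ω), 0 ≤ β x ∧ β x ≤ b₁)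

theorem memLp_bdd_smul {X E : Type*} [MeasurableSpace X] [NormedAddCommGroup E] [NormedSpace ℝ E]
    {μ : Measure X} {γ : X → ℝ} {f : X → E} {c : ℝ} (hγm : AEStronglyMeasurable γ μ)
    (hγ : ∀ᵐ x ∂μ, ‖γ x‖ ≤ c) (hf : MemLp f 2 μ) : MemLp (fun x => γ x • f x) 2 μ :=
  hf.smul (memLp_top_of_bound hγm c hγ)

include hαm hα ha₀ in
theorem aestronglyMeasurable_rpow_coeff (s : ℝ) :
    AEStronglyMeasurable (fun x => α x ^ s) (area Ω) ∧
      ∃ c, ∀ᵐ x ∂(area Ω), ‖α x ^ s‖ ≤ c := by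
  refine ⟨(hαm.aemeasurable.pow_const s).aestronglyMeasurable, ?_⟩
  have hcont : ContinuousOn (fun t : ℝ => t ^ s) (Set.Icc a₀ a₁) := fun t ht =>
    (Real.continuousAt_rpow_const t s (Or.inl (ha₀.trans_le ht.1).ne')).continuousWithinAt
  obtain ⟨c, hc⟩ := isCompact_Icc.exists_bound_of_continuousOn hcont
  exact ⟨c, hα.mono fun x hx => hc _ hx⟩

include hαm hα ha₀ hβm hβ hsplit hp in
/-- The error equation, bounded by the Cauchy-Schwarz inequality. -/
theorem energy_sq_le [IsFiniteMeasure (arc Ω₁)] {C : ℝ} (hC0 : 0 ≤ C)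
    (hC : ∀ φ : 𝓓(Ω, ℝ), ‖restrTest Ω Ω₁ φ‖ ^ 2 ≤
      C * (‖fnL Ω (ofTest Ω φ)‖ * ‖gradL Ω (ofTest Ω φ)‖))
    {l m : ℝ} (hl : 0 < l) (hm : 0 < m)
    (hlB : ∀ v : H10 Ω, l * ‖fnL Ω v‖ ^ 2 ≤ form α β v v)
    (hmB : ∀ v : H10 Ω, m * ‖traceL Ω Ω₁ v‖ ^ 2 ≤ form α β v v)
    {f g : Plane → ℝ} (hf : MemLp f 2 (area Ω)) {u : H10 Ω}
    (hu : IsWeakSolution Ω₁ α β f g u) (uN : H10 Ω) {h : Plane → ℝ} (hh : MemLp h 2 (arc Ω₁))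
    (hrep : ∀ v : H10 Ω, arcPairing Ω₁ g v - normalJump Ω₁ p v = arcPairing Ω₁ h v) :
    ENNReal.ofReal (form α β (u - uN) (u - uN)) ≤ ENNReal.ofReal (1 + 1 / l + 1 / m) *
      (eLpNorm (fun x => f x - β x * fn uN x + pwDiv Ω Ω₁ p x) 2 (area Ω) ^ 2
        + eLpNorm (fun x => (α x) ^ (-(1 / 2) : ℝ) • (p x - α x • grad uN x)) 2 (area Ω) ^ 2
        + eLpNorm h 2 (arc Ω₁) ^ 2) := by
  obtain ⟨B, hB⟩ := exists_bilinForm_eq_form hαm hα ha₀ hβm hβ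
  set e := u - uN with he
  have hE0 : 0 ≤ form α β e e :=
    (by positivity : 0 ≤ l * ‖fnL Ω e‖ ^ 2).trans (hlB e)
  have hpL := memLp_of_mem_Hdiv hsplit hp
  have hdL := memLp_pwDiv hsplit hp
  have hfnN : MemLp (fn uN) 2 (area Ω) := Lp.memLp _
  have hfe : MemLp (fn e) 2 (area Ω) := Lp.memLp _
  have hgN : MemLp (grad uN) 2 (area Ω) := Lp.memLp _
  have hge : MemLp (grad e) 2 (area Ω) := Lp.memLp _
  have hαgN : MemLp (fun x => α x • grad uN x) 2 (area Ω) :=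
    memLp_bdd_smul (c := a₁) hαm (hα.mono fun x hx => by
      rw [Real.norm_of_nonneg (ha₀.le.trans hx.1)]; exact hx.2) hgN
  have hβfN : MemLp (fun x => β x * fn uN x) 2 (area Ω) :=
    memLp_bdd_smul (c := b₁) hβm (hβ.mono fun x hx => by
      rw [Real.norm_of_nonneg hx.1]; exact hx.2) hfnN
  have hr1 : MemLp (fun x => f x - β x * fn uN x + pwDiv Ω Ω₁ p x) 2 (area Ω) :=
    (hf.sub hβfN).add hdL
  obtain ⟨hm1, c1, hc1⟩ := aestronglyMeasurable_rpow_coeff hαm hα ha₀ (-(1 / 2))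
  obtain ⟨hm2, c2, hc2⟩ := aestronglyMeasurable_rpow_coeff hαm hα ha₀ (1 / 2)
  have hr2 : MemLp (fun x => (α x) ^ (-(1 / 2) : ℝ) • (p x - α x • grad uN x)) 2 (area Ω) :=
    memLp_bdd_smul hm1 hc1 (hpL.sub hαgN)
  have hs : MemLp (fun x => (α x) ^ (1 / 2 : ℝ) • grad e x) 2 (area Ω) :=
    memLp_bdd_smul hm2 hc2 hge
  have hT : MemLp (traceL Ω Ω₁ e) 2 (arc Ω₁) := Lp.memLp _
  -- The error equation: test the weak formulation with e, replace g by [n⬝p] + h as functionals,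
  -- and write the jump as an integral over Ω. The weights α^(-1/2) and α^(1/2) cancel in the inner
  -- product.
  have key : form α β e e = (∫ x, (f x - β x * fn uN x + pwDiv Ω Ω₁ p x) * fn e x ∂(area Ω))
      + (∫ x, inner ℝ ((α x) ^ (-(1 / 2) : ℝ) • (p x - α x • grad uN x))
          ((α x) ^ (1 / 2 : ℝ) • grad e x) ∂(area Ω))
      + ∫ x, h x * traceL Ω Ω₁ e x ∂(arc Ω₁) := by
    have h1 : form α β e e = pairing f e + arcPairing Ω₁ g e - form α β uN e := by
      rw [← hu e, ← hB, ← hB, ← hB, ← LinearMap.sub_apply, ← map_sub]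
    have h2 : arcPairing Ω₁ g e = normalJump Ω₁ p e + ∫ x, h x * traceL Ω Ω₁ e x ∂(arc Ω₁) := by
      rw [← arcPairing_eq hC0 hC, ← hrep e]; ring
    have h3 : (∫ x, inner ℝ ((α x) ^ (-(1 / 2) : ℝ) • (p x - α x • grad uN x))
          ((α x) ^ (1 / 2 : ℝ) • grad e x) ∂(area Ω))
        = ∫ x, inner ℝ (p x - α x • grad uN x) (grad e x) ∂(area Ω) := by
      refine integral_congr_ae (hα.mono fun x hx => ?_)
      have hpos : 0 < α x := ha₀.trans_le hx.1
      simp only []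
      rw [real_inner_smul_left, real_inner_smul_right, ← mul_assoc, ← Real.rpow_add hpos]
      norm_num
    have i1 : Integrable (fun x => (f x - β x * fn uN x + pwDiv Ω Ω₁ p x) * fn e x) (area Ω) :=
      hr1.integrable_mul hfe
    have i2 : Integrable (fun x => (inner ℝ (p x - α x • grad uN x) (grad e x) : ℝ)) (area Ω) :=
      integrable_inner_of_memLp (hpL.sub hαgN) hge
    have i3 : Integrable (fun x => f x * fn e x) (area Ω) := hf.integrable_mul hfe
    have i4 : Integrable (fun x => inner ℝ (p x) (grad e x) + pwDiv Ω Ω₁ p x * fn e x) (area Ω) :=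
      (integrable_inner_of_memLp hpL hge).add (hdL.integrable_mul hfe)
    have i5 := integrable_form hαm hα ha₀ hβm hβ uN e
    rw [h1, h2, h3, normalJump_eq hsplit hp, pairing, form, ← integral_add i1 i2]
    have h4 : (∫ x, f x * fn e x ∂(area Ω))
        + (∫ x, (inner ℝ (p x) (grad e x) + pwDiv Ω Ω₁ p x * fn e x) ∂(area Ω))
        - (∫ x, (α x * inner ℝ (grad uN x) (grad e x) + β x * fn uN x * fn e x) ∂(area Ω))
        = ∫ x, ((f x - β x * fn uN x + pwDiv Ω Ω₁ p x) * fn e x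
          + inner ℝ (p x - α x • grad uN x) (grad e x)) ∂(area Ω) := by
      have i6 : Integrable (fun x => f x * fn e x
          + (inner ℝ (p x) (grad e x) + pwDiv Ω Ω₁ p x * fn e x)) (area Ω) := i3.add i4
      rw [← integral_add i3 i4, ← integral_sub i6 i5]
      refine integral_congr_ae (Eventually.of_forall fun x => ?_)
      simp only [inner_sub_left, real_inner_smul_left]
      ring
    linarith
  have hsn : ‖hs.toLp _‖ ^ 2 ≤ form α β e e := by
    rw [norm_sq_toLp_eq_integral]
    refine le_trans (le_of_eq ?_) (integral_coeff_grad_sq_le_form hαm hα ha₀ hβm hβ e)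
    refine integral_congr_ae (hα.mono fun x hx => ?_)
    have hpos : 0 < α x := ha₀.trans_le hx.1
    simp only []
    rw [norm_smul, mul_pow, Real.norm_eq_abs, sq_abs, ← Real.rpow_natCast, ← Real.rpow_mul hpos.le]
    norm_num
  have hfn : hfe.toLp _ = fnL Ω e := Lp.toLp_coeFn _ _
  have htr : hT.toLp _ = traceL Ω Ω₁ e := Lp.toLp_coeFn _ _
  have hbound := sq_le_of_le_sum_mul hl hm hE0 (key.le.trans
    (add_le_add (add_le_add (integral_mul_le hr1 hfe) (integral_inner_le hr2 hs))
      (integral_mul_le hh hT))) (by rw [hfn]; exact hlB e) hsn (by rw [htr]; exact hmB e)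
  rw [eLpNorm_eq_ofReal_norm hr1, eLpNorm_eq_ofReal_norm hr2, eLpNorm_eq_ofReal_norm hh,
    ← ENNReal.ofReal_pow (norm_nonneg _), ← ENNReal.ofReal_pow (norm_nonneg _),
    ← ENNReal.ofReal_pow (norm_nonneg _), ← ENNReal.ofReal_add (sq_nonneg _) (sq_nonneg _),
    ← ENNReal.ofReal_add (by positivity) (sq_nonneg _), ← ENNReal.ofReal_mul (by positivity)]
  exact ENNReal.ofReal_le_ofReal hbound

end Estimate

/-- Passes from each representative of the jump residual to the infimum in `arcNorm`. Solving the
inequality for N i makes the other side independent of i. If no representative exists, the infimum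
is ∞ and the bound is trivial; no separate case is needed. -/
theorem ofReal_sqrt_le_of_forall_le {ι : Type*} {P : ι → Prop} {N : ι → ℝ≥0∞} {E c : ℝ}
    (hc : 0 < c) {a b : ℝ≥0∞}
    (h : ∀ i, P i → ENNReal.ofReal E ≤ ENNReal.ofReal c * (a + b + N i ^ 2)) :
    ENNReal.ofReal √E ≤
      ENNReal.ofReal √c * (a + b + (⨅ (i : ι) (_ : P i), N i) ^ 2) ^ (1 / 2 : ℝ) := by
  have hsq : ∀ r : ℝ, ENNReal.ofReal √r = ENNReal.ofReal r ^ (1 / 2 : ℝ) := fun r => by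
    rcases le_total 0 r with hr | hr
    · rw [Real.sqrt_eq_rpow, ENNReal.ofReal_rpow_of_nonneg hr (by norm_num)]
    · rw [Real.sqrt_eq_zero_of_nonpos hr, ENNReal.ofReal_of_nonpos hr]; simp
  rw [hsq, hsq, ← ENNReal.mul_rpow_of_nonneg _ _ (by norm_num)]
  refine ENNReal.rpow_le_rpow ?_ (by norm_num)
  have hc0 : ENNReal.ofReal c ≠ 0 := by simpa using hc
  have hct : ENNReal.ofReal c ≠ ∞ := ENNReal.ofReal_ne_top
  rw [← ENNReal.div_le_iff' hc0 hct, ← tsub_le_iff_left, ← ENNReal.rpow_two,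
    ← ENNReal.rpow_inv_le_iff (by norm_num)]
  refine le_iInf₂ fun i hi => ?_
  rw [ENNReal.rpow_inv_le_iff (by norm_num), ENNReal.rpow_two, tsub_le_iff_left,
    ENNReal.div_le_iff' hc0 hct]
  exact h i hi

/-! ### Verification of the hypotheses and assembly -/

theorem IsConvexPolygon.exists_subset_ball {Ω : Opens Plane} (hΩ : IsConvexPolygon Ω) :
    ∃ R : ℝ, 0 < R ∧ (Ω : Set Plane) ⊆ Metric.ball 0 R := by
  obtain ⟨-, S, hS⟩ := hΩ
  have hb : Bornology.IsBounded (Ω : Set Plane) := by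
    rw [hS]
    exact (isBounded_convexHull.2 S.finite_toSet.isBounded).subset interior_subset
  obtain ⟨R, hR⟩ := hb.subset_ball_lt 0 0
  exact ⟨R, hR.1, hR.2⟩

/-- The trace inequality for test functions. -/
theorem exists_norm_restrTest_sq_le {Ω Ω₁ : Opens Plane} [IsFiniteMeasure (arc Ω₁)]
    (hD : HasLipschitzBoundary (Ω₁ : Set Plane)) (hc : IsCompact (frontier (Ω₁ : Set Plane))) :
    ∃ C : ℝ, 0 ≤ C ∧ ∀ φ : 𝓓(Ω, ℝ), ‖restrTest Ω Ω₁ φ‖ ^ 2 ≤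
      C * (‖fnL Ω (ofTest Ω φ)‖ * ‖gradL Ω (ofTest Ω φ)‖) := by
  obtain ⟨C, hC⟩ := exists_trace_inequality hD hc
  refine ⟨C, C.2, fun φ => ?_⟩
  have h := hC φ (contDiff_one_test φ) φ.hasCompactSupport
  rw [← norm_sq_fnL_ofTest, ← norm_sq_gradL_ofTest, Real.sqrt_sq (norm_nonneg _),
    Real.sqrt_sq (norm_nonneg _)] at h
  have h1 : ‖restrTest Ω Ω₁ φ‖ ^ 2 = ∫ x, φ x ^ 2 ∂(arc Ω₁) := by
    have := norm_sq_toLp_eq_integral (memLp_test_arc Ω₁ φ)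
    simp only [Real.norm_eq_abs, sq_abs] at this
    exact this
  rw [h1, integral_eq_lintegral_of_nonneg_ae (Eventually.of_forall fun x => sq_nonneg _)
    (φ.continuous.pow 2).aestronglyMeasurable]
  refine ENNReal.toReal_le_of_le_ofReal (by positivity) (h.trans (le_of_eq ?_))
  rw [ENNReal.ofReal_mul NNReal.zero_le_coe, ENNReal.ofReal_coe_nnreal]

theorem exists_coeff_bounds (Ω Ω₁ : Opens Plane) {α₁ α₂ : ℝ} (hα₁ : 0 < α₁) (hα₂ : 0 < α₂) :
    ∃ a₀ a₁ : ℝ, 0 < a₀ ∧ AEStronglyMeasurable (coeff Ω₁ α₁ α₂) (area Ω) ∧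
      ∀ᵐ x ∂(area Ω), a₀ ≤ coeff Ω₁ α₁ α₂ x ∧ coeff Ω₁ α₁ α₂ x ≤ a₁ := by
  refine ⟨min α₁ α₂, max α₁ α₂, lt_min hα₁ hα₂, ?_, Eventually.of_forall fun x => ?_⟩
  · exact (Measurable.ite Ω₁.isOpen.measurableSet measurable_const
      measurable_const).aestronglyMeasurable
  · unfold coeff
    split_ifs
    exacts [⟨min_le_left _ _, le_max_left _ _⟩, ⟨min_le_right _ _, le_max_right _ _⟩]

/-- The smallest Rayleigh quotient is the least eigenvalue. -/
theorem le_of_eigenvalue {H L : Type*} [NormedAddCommGroup L] [InnerProductSpace ℝ L]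
    {B : H → H → ℝ} {T : H → L} {lam μ : ℝ} (hle : ∀ v, lam * ‖T v‖ ^ 2 ≤ B v v) {w : H}
    (hpos : 0 < B w w) (hw : B w w = μ * inner ℝ (T w) (T w)) : lam ≤ μ := by
  rw [real_inner_self_eq_norm_sq] at hw
  have hT : 0 < ‖T w‖ ^ 2 := by
    refine (sq_nonneg _).lt_of_ne fun h0 => ?_
    rw [← h0, mul_zero] at hw
    exact hpos.ne' hw
  have := hle w
  rw [hw] at this
  exact le_of_mul_le_mul_right this hT

end Interface

end

theorem mainTheorem2 (Ω Ω₁ : Opens Interface.Plane)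
    (hΩ : Interface.IsConvexPolygon Ω)
    (hΩ₁_nonempty : (Ω₁ : Set Interface.Plane).Nonempty)
    (hΩ₁_sub : (Ω₁ : Set Interface.Plane) ⊆ Ω)
    (hΓ_sub : frontier (Ω₁ : Set Interface.Plane) ⊆ Ω)
    (hΓ_lip : Interface.HasLipschitzBoundary (Ω₁ : Set Interface.Plane))
    (α₁ α₂ : ℝ) (hα₁ : 0 < α₁) (hα₂ : 0 < α₂)
    (β : Interface.Plane → ℝ) (hβ : MemLp β ∞ (Interface.area Ω))
    (hβ_nonneg : ∀ᵐ x ∂(Interface.area Ω), 0 ≤ β x) :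
    ∃ lamMin lamGamma : ℝ,
      0 < lamMin ∧
      IsLeast (Interface.dirichletEigenvalues Ω (Interface.coeff Ω₁ α₁ α₂) β) lamMin ∧
      0 < lamGamma ∧
      IsLeast (Interface.steklovEigenvalues Ω Ω₁ (Interface.coeff Ω₁ α₁ α₂) β) lamGamma ∧
      ∀ f g : Interface.Plane → ℝ, MemLp f 2 (Interface.area Ω) → MemLp g 2 (Interface.arc Ω₁) →
        ∀ u : Interface.H10 Ω,
          Interface.IsWeakSolution Ω₁ (Interface.coeff Ω₁ α₁ α₂) β f g u →
          ∀ uN : Interface.H10 Ω,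
            ∀ p ∈ Interface.Hdiv Ω₁ ∩ Interface.Hdiv (Interface.outer Ω Ω₁),
              ENNReal.ofReal (Interface.energyNorm (Interface.coeff Ω₁ α₁ α₂) β (u - uN)) ≤
                ENNReal.ofReal √(1 + 1 / lamMin + 1 / lamGamma) *
                  Interface.eta Ω₁ (Interface.coeff Ω₁ α₁ α₂) β f g uN p := by
  open Interface in
  obtain ⟨R, hR, hΩR⟩ := hΩ.exists_subset_ball
  have hbdd : Bornology.IsBounded (Ω₁ : Set Plane) :=
    Metric.isBounded_ball.subset (hΩ₁_sub.trans hΩR)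
  have hΓc : IsCompact (frontier (Ω₁ : Set Plane)) :=
    Metric.isCompact_of_isClosed_isBounded isClosed_frontier
      (Metric.isBounded_ball.subset (hΓ_sub.trans hΩR))
  -- In a connected space only the empty set and the whole space have empty frontier; Ω₁ is
  -- nonempty, and it is bounded while the plane is not.
  have hΓne : (frontier (Ω₁ : Set Plane)).Nonempty :=
    nonempty_frontier_iff.2 ⟨hΩ₁_nonempty, fun h => NormedSpace.unbounded_univ ℝ Plane (h ▸ hbdd)⟩
  have : IsFiniteMeasure (arc Ω₁) :=
    isFiniteMeasure_restrict.2 (hausdorffMeasure_frontier_lt_top hΓ_lip hΓc).ne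
  obtain ⟨C, hC0, hC⟩ := exists_norm_restrTest_sq_le (Ω := Ω) hΓ_lip hΓc
  obtain ⟨a₀, a₁, ha₀, hαm, hα⟩ := exists_coeff_bounds Ω Ω₁ hα₁ hα₂
  have hβm := hβ.aestronglyMeasurable
  obtain ⟨b₁, hβb⟩ : ∃ b₁ : ℝ, ∀ᵐ x ∂(area Ω), 0 ≤ β x ∧ β x ≤ b₁ := by
    refine ⟨(eLpNorm β ∞ (area Ω)).toReal, ?_⟩
    filter_upwards [hβ_nonneg, ae_le_eLpNormEssSup (f := β) (μ := area Ω)] with x h0 h1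
    refine ⟨h0, ?_⟩
    rw [← eLpNorm_exponent_top] at h1
    have := ENNReal.toReal_mono hβ.2.ne h1
    rw [toReal_enorm, Real.norm_eq_abs] at this
    exact (le_abs_self _).trans this
  set α := coeff Ω₁ α₁ α₂
  obtain ⟨B, hB⟩ := exists_bilinForm_eq_form hαm hα ha₀ hβm hβb
  have hBsymm : ∀ u v, B u v = B v u := fun u v => by rw [hB, hB, form_symm]
  have hm : 0 < a₀ / ((4 * R) ^ 2 + 1) := by positivity
  have hmB : ∀ v : H10 Ω, a₀ / ((4 * R) ^ 2 + 1) * ‖v‖ ^ 2 ≤ B v v := fun v => by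
    rw [hB]; exact le_form_self hαm hα ha₀ hβm hβb hR hΩR v
  have hMB : ∀ v : H10 Ω, B v v ≤ (|a₁| + |b₁|) * ‖v‖ ^ 2 := fun v => by
    rw [hB]; exact form_self_le hαm hα ha₀ hβm hβb v
  have hpos : ∀ w : H10 Ω, w ≠ 0 → 0 < form α β w w := fun w hw => by
    rw [← hB]
    exact (mul_pos hm (pow_pos (norm_pos_iff.2 hw) 2)).trans_le (hmB w)
  have hfnc := totallyBounded_fnL hR hΩR
  have htrc := totallyBounded_traceL hC0 hC hfnc
  obtain ⟨v₀, hv₀⟩ := exists_traceL_ne_zero hC0 hC hΓ_lip hΓne hΓ_sub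
  -- The multiplicative trace inequality lets the same v₀ witness that the embedding is nonzero as
  -- well.
  have hv₀' : fnL Ω v₀ ≠ 0 := fun h0 => by
    have := norm_traceL_sq_le hC0 hC v₀
    rw [h0, norm_zero, zero_mul, mul_zero] at this
    exact hv₀ (norm_eq_zero.1 (pow_eq_zero_iff two_ne_zero |>.1 (le_antisymm this (sq_nonneg _))))
  obtain ⟨l, hl, ⟨w, hw, hwe⟩, hlB⟩ :=
    exists_rayleigh_minimizer B hBsymm _ _ hm hmB hMB (fnL Ω) hfnc v₀ hv₀'
  obtain ⟨m, hm', ⟨z, hz, hze⟩, hmB'⟩ :=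
    exists_rayleigh_minimizer B hBsymm _ _ hm hmB hMB (traceL Ω Ω₁) htrc v₀ hv₀
  simp only [hB] at hwe hlB hze hmB'
  refine ⟨l, m, hl, ⟨⟨w, hw, fun v => ?_⟩, ?_⟩, hm', ⟨⟨z, hz, fun v => ?_⟩, ?_⟩, ?_⟩
  · rw [hwe, pairing_fn_eq]
  · rintro μ ⟨y, hy, hye⟩
    refine le_of_eigenvalue hlB (hpos y hy) ?_
    rw [hye, pairing_fn_eq]
  · rw [hze, arcPairing_trace_eq hC0 hC]
  -- Testing an eigenvector with itself gives a positive value of the form, so its trace cannot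
  -- vanish and its eigenvalue is a Rayleigh quotient.
  · rintro μ ⟨y, hy, hye⟩
    refine le_of_eigenvalue hmB' (hpos y hy) ?_
    rw [hye, arcPairing_trace_eq hC0 hC]
  · intro f g hf hg u hu uN p hp
    have hsplit := area_eq_add hΩ₁_sub (volume_frontier_eq_zero hΓ_lip hΓc)
    exact ofReal_sqrt_le_of_forall_le (by positivity) fun h hh =>
      energy_sq_le hsplit hp hαm hα ha₀ hβm hβb hC0 hC hl hm' hlB hmB' hf hu uN hh.1 hh.2
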